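/- Let $k\ge 1$ be an integer, let $d_k(n)$ be the number of ordered $k$-tuples of positive integers with product $n$, and for $\rho>0$, $x>0$ put $$\Psi_{\rho,k}(x)=\frac{\pi^{k/2-1}}{2^{k-1}}\sum_{j=1}^{\infty}d_k(j)\,G^{k+1,0}_{0,2k}\!\left(\begin{matrix}\text{---}\\ (0)_k,\tfrac12:(\tfrac12)_{k-1}\end{matrix}\ \Big|\ \frac{\rho^2j^2x^2}{2^{2k}}\right),$$ where $(a)_r$ means $a$ repeated $r$ times and the Meijer $G$-function is, for $z>0$ and any fixed $c<0$, $$G^{k+1,0}_{0,2k}\!\left(\begin{matrix}\text{---}\\ (0)_k,\tfrac12:(\tfrac12)_{k-1}\end{matrix}\ \Big|\ z\right)=\frac1{2\pi i}\int_{c-i\infty}^{c+i\infty}\frac{\Gamma(-s)^k\,\Gamma(\tfrac12-s)}{\Gamma(\tfrac12+s)^{k-1}}\,z^s\,ds .$$ These integrals and the series defining $\Psi_{\rho,k}(x)$ converge absolutely. For all real $\alpha,\beta>0$ with $\alpha\beta=\pi^2$, the two series below converge absolutely and $$\sum_{n=1}^{\infty}\frac{d_k(n)}{n}\Psi_{(2\alpha)^k,k}(n)-\sum_{n=1}^{\infty}\frac{d_k(n)}{n}\Psi_{(2\beta)^k,k}(n)$$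 $$=\frac{(-1)^k2^k}{(2k-1)!}\,\frac{d^{2k-1}}{ds^{2k-1}}\left(\Gamma^k(1+s)\,\Gamma^k(1-s)\,\zeta^k(s)\,\zeta^k(-s)\cos^{2k-1}\!\left(\frac{\pi s}{2}\right)\left(\frac{\alpha}{\beta}\right)^{-ks/2}\right)\Bigg|_{s=0}+2\,\frac{(-1)^{k+1}\pi^{k-1}}{24^k}\left(\beta^k-\alpha^k\right).$$ -/

import Mathlib

open scoped Nat

noncomputable section

/-- The Piltz divisor function `d_k(n)`: the number of ordered `k`-tuples of positive integers
whose product is `n` (for `n ≥ 1`; the value at `n = 0` is `0`). -/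
def piltz (k n : ℕ) : ℕ := (Nat.finMulAntidiag k n).card

/-- The integrand in the Mellin-Barnes integral of the Meijer `G`-function `G^{m,n}_{p,q}`, where
`a = [a₁, …, a_p]` and `b = [b₁, …, b_q]` are the two parameter lists:
`∏_{j ≤ m} Γ(b_j - s) ∏_{j ≤ n} Γ(1 - a_j + s)
  / (∏_{j > m} Γ(1 - b_j + s) ∏_{j > n} Γ(a_j - s)) * z ^ s`. -/
def meijerGIntegrand (m n : ℕ) (a b : List ℂ) (z s : ℂ) : ℂ :=
  (((b.take m).map fun bj => Complex.Gamma (bj - s)).prod *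
      ((a.take n).map fun aj => Complex.Gamma (1 - aj + s)).prod) /
    (((b.drop m).map fun bj => Complex.Gamma (1 - bj + s)).prod *
      ((a.drop n).map fun aj => Complex.Gamma (aj - s)).prod) * z ^ s

/-- The Meijer `G`-function as the integral `(1 / 2πi) ∫_{(c)} … ds` over the vertical line
`s = c + i t`, `t` running from `-∞` to `∞` (so `ds = i dt`). -/
def meijerG (c : ℝ) (m n : ℕ) (a b : List ℂ) (z : ℂ) : ℂ :=
  1 / (2 * Real.pi * Complex.I) *
    ∫ t : ℝ, meijerGIntegrand m n a b z (c + t * Complex.I) * Complex.I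

/-- The lower parameters `(0)_k, 1/2 : (1/2)_{k-1}`; there are `2k` of them for `k ≥ 1`. -/
def psiParams (k : ℕ) : List ℂ :=
  List.replicate k 0 ++ [1 / 2] ++ List.replicate (k - 1) (1 / 2)

/-- The argument `ρ² j² x² / 2^{2k}` of the `G`-function in the `j`-th term of `Ψ_{ρ,k}(x)`. -/
def psiArg (k : ℕ) (ρ x : ℝ) (j : ℕ+) : ℝ :=
  ρ ^ 2 * (j : ℝ) ^ 2 * x ^ 2 / 2 ^ (2 * k)

/-- The `j`-th term `d_k(j) G^{k+1,0}_{0,2k}(— ; (0)_k, 1/2 : (1/2)_{k-1} | ρ² j² x² / 2^{2k})`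
of the series that defines `Ψ_{ρ,k}(x)`, the `G`-function being taken over the line `Re s = c`.
The poles of the gamma factors `Γ(-s)` and `Γ(1/2 - s)` lie to the right of this line exactly when
`c < 0`. -/
def psiTerm (c : ℝ) (k : ℕ) (ρ x : ℝ) (j : ℕ+) : ℂ :=
  (piltz k j : ℂ) * meijerG c (k + 1) 0 [] (psiParams k) (psiArg k ρ x j : ℂ)

/-- `Ψ_{ρ,k}(x) = π^{k/2-1} / 2^{k-1} ∑_{j ≥ 1} d_k(j) G(ρ² j² x² / 2^{2k})`. -/
def Psi (c : ℝ) (k : ℕ) (ρ x : ℝ) : ℂ :=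
  ((Real.pi ^ ((k : ℝ) / 2 - 1) / 2 ^ (k - 1) : ℝ) : ℂ) * ∑' j : ℕ+, psiTerm c k ρ x j

/-- The `n`-th term `d_k(n) n^{-1} Ψ_{ρ,k}(n)` of the generalised series for `log η`. -/
def etaTerm (c : ℝ) (k : ℕ) (ρ : ℝ) (n : ℕ+) : ℂ :=
  (piltz k n : ℂ) / (n : ℂ) * Psi c k ρ (n : ℝ)

end

/-! With w = -2s, the duplication and reflection formulas turn the gamma quotient of the
Mellin-Barnes integrand into `gammaKernel`. On a line Re w > 1, summing over j and n under the
integral sign produces ζ(w)^k ζ(1+w)^k, and the functional equation for ζ(1-w) then rewrites each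
eta-series as a constant times the integral over Re w = 3/2 of (ζ(1-w) ζ(1+w))^k / cos(πw/2) ·
q^(-w), with q = (α/π)^k (`hasSum_etaTerm_zetaKernel`). This `zetaKernel` is invariant under w ↦ -w,
q ↦ 1/q, and αβ = π² says exactly that β belongs to 1/q. So the difference of the two series is a
difference of integrals over Re w = 3/2 and Re w = -3/2, hence a sum of residues
(`integral_zetaKernel_sub_inv`). The pole at 0 has order 2k and gives the derivative of order 2k-1;
the simple poles at 1 and -1, zeros of the cosine, give the terms in α^k and β^k through ζ(0)ζ(2) =
-π²/12.

The analytic input is a residue theorem for a strip (`integral_line_sub_integral_line`), decay of Γ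
at any exponential rate below π/2 (`exists_norm_Gamma_le`), and growth of ζ below every e^(ε|t|)
(`exists_norm_riemannZeta_le`). Together they justify all interchanges and shifts. -/

section

open Filter Topology Complex MeasureTheory

/-! ### Residue theorem for a vertical strip -/

/-- Taylor expansion with remainder in terms of iterated divided slopes. -/
theorem eq_sum_iterate_dslope (g : ℂ → ℂ) (p : ℂ) (n : ℕ) (z : ℂ) :
    g z = (∑ i ∈ Finset.range n, ((Function.swap dslope p)^[i] g p) * (z - p) ^ i) +
      (z - p) ^ n * (Function.swap dslope p)^[n] g z := by
  induction n with
  | zero => simp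
  | succ n ih =>
    rw [Finset.sum_range_succ, Function.iterate_succ_apply']
    have := sub_smul_dslope ((Function.swap dslope p)^[n] g) p z
    simp only [smul_eq_mul] at this
    rw [pow_succ, mul_assoc, Function.swap, this]
    linear_combination ih

theorem differentiableOn_iterate_dslope {g : ℂ → ℂ} {U : Set ℂ} {p : ℂ} (hU : U ∈ nhds p)
    (hg : DifferentiableOn ℂ g U) (n : ℕ) :
    DifferentiableOn ℂ ((Function.swap dslope p)^[n] g) U := by
  induction n with
  | zero => exact hg
  | succ n ih =>
    rw [Function.iterate_succ_apply']
    exact (Complex.differentiableOn_dslope hU).2 ih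

/-- Each slope at p shifts the power series by one place, so the constant term left after n of them
is the n-th Taylor coefficient. This will be the residue. -/
theorem iterate_dslope_apply_same {g : ℂ → ℂ} {p : ℂ} (hg : AnalyticAt ℂ g p) (n : ℕ) :
    (Function.swap dslope p)^[n] g p = iteratedDeriv n g p / n ! := by
  have h := hg.hasFPowerSeriesAt.has_fpower_series_iterate_dslope_fslope n
  rw [← h.coeff_zero 1, ← FormalMultilinearSeries.coeff,
    FormalMultilinearSeries.coeff_iterate_fslope]
  simp [FormalMultilinearSeries.coeff_ofScalars]

theorem ofReal_add_mul_I_ne_zero {b : ℝ} (hb : b ≠ 0) (t : ℝ) : (b + t * Complex.I : ℂ) ≠ 0 := by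
  intro h
  have := congrArg Complex.re h
  simp at this
  exact hb this


theorem tendsto_norm_ofReal_add_mul_I_atTop (b : ℝ) {l : Filter ℝ} {u : ℝ → ℝ}
    (hu : Tendsto (fun t => |u t|) l atTop) :
    Tendsto (fun t => ‖(b + u t * I : ℂ)‖) l atTop := by
  refine tendsto_atTop_mono (fun t => ?_) hu
  simpa using Complex.abs_im_le_norm (b + u t * I : ℂ)

/-- From exponent 2 on there is a primitive that vanishes at both ends, so polar terms of higher
order contribute nothing along a line. -/
theorem tendsto_integral_inv_pow {b : ℝ} (hb : b ≠ 0) (m : ℕ) :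
    Tendsto (fun T : ℝ => ∫ t in (-T)..T, ((b + t * I : ℂ) ^ (m + 2))⁻¹) atTop (𝓝 0) := by
  have hd : ∀ t : ℝ, HasDerivAt (fun t : ℝ => (I / (m + 1)) * ((b + t * I : ℂ) ^ (m + 1))⁻¹)
      (((b + t * I : ℂ) ^ (m + 2))⁻¹) t := by
    intro t
    have h0 := ofReal_add_mul_I_ne_zero hb t
    have h1 : HasDerivAt (fun t : ℝ => (b + t * I : ℂ)) I t := by
      simpa using ((Complex.ofRealCLM.hasDerivAt (x := t)).mul_const I).const_add (b : ℂ)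
    have h2 := ((h1.pow (m + 1)).inv (pow_ne_zero _ h0)).const_mul (I / (m + 1 : ℂ))
    convert! h2 using 1
    have : (m + 1 : ℂ) ≠ 0 := by exact_mod_cast m.succ_ne_zero
    simp only [Nat.add_sub_cancel]
    simp only [Pi.pow_apply]
    push_cast
    field_simp
    linear_combination ((b + t * I : ℂ) ^ (2 * m + 2)) * I_sq
  have hc : Continuous fun t : ℝ => ((b + t * I : ℂ) ^ (m + 2))⁻¹ := by
    refine Continuous.inv₀ (by fun_prop) fun t => pow_ne_zero _ (ofReal_add_mul_I_ne_zero hb t)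
  have hF : ∀ T : ℝ, ∫ t in (-T)..T, ((b + t * I : ℂ) ^ (m + 2))⁻¹ =
      (I / (m + 1)) * ((b + T * I : ℂ) ^ (m + 1))⁻¹ -
        (I / (m + 1)) * ((b + (-T : ℝ) * I : ℂ) ^ (m + 1))⁻¹ := fun T =>
    intervalIntegral.integral_eq_sub_of_hasDerivAt (fun t _ => hd t) (hc.intervalIntegrable _ _)
  simp_rw [hF]
  have hlim : ∀ u : ℝ → ℝ, Tendsto (fun t => |u t|) atTop atTop →
      Tendsto (fun T : ℝ => (I / (m + 1)) * ((b + u T * I : ℂ) ^ (m + 1))⁻¹) atTop (𝓝 0) := by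
    intro u hu
    have : Tendsto (fun T : ℝ => ((b + u T * I : ℂ) ^ (m + 1))⁻¹) atTop (𝓝 0) := by
      rw [tendsto_zero_iff_norm_tendsto_zero]
      simp_rw [norm_inv, norm_pow]
      exact ((tendsto_pow_atTop (by omega)).comp
        (tendsto_norm_ofReal_add_mul_I_atTop b hu)).inv_tendsto_atTop
    simpa using this.const_mul (I / (m + 1))
  simpa using (hlim (fun T => T) tendsto_abs_atTop_atTop).sub
    (hlim (fun T => -T) (by simpa using tendsto_abs_atTop_atTop))

/-- A primitive is arctan(t/b) - (i/2) log(b² + t²); its even logarithmic part cancels over a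
symmetric interval. The limits ±π on the two sides of a simple pole differ by 2π, the factor of the
residue. -/
theorem integral_inv_ofReal_add_mul_I {b : ℝ} (hb : b ≠ 0) (T : ℝ) :
    ∫ t in (-T)..T, (b + t * I : ℂ)⁻¹ = (2 * Real.arctan (T / b) : ℝ) := by
  have hpos : ∀ t : ℝ, 0 < b ^ 2 + t ^ 2 := fun t => by positivity
  have hd : ∀ t : ℝ, HasDerivAt
      (fun t : ℝ => ((Real.arctan (t / b) : ℝ) : ℂ) - I / 2 * (Real.log (b ^ 2 + t ^ 2) : ℝ))
      ((b + t * I : ℂ)⁻¹) t := by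
    intro t
    have h1 := (((hasDerivAt_id t).div_const b).arctan).ofReal_comp
    have h2 := ((((hasDerivAt_id t).pow 2).const_add (b ^ 2)).log (hpos t).ne').ofReal_comp
    have h3 := h1.sub (h2.const_mul (I / 2))
    convert! h3 using 1
    have h0 := ofReal_add_mul_I_ne_zero hb t
    have hb' : (b : ℂ) ≠ 0 := by exact_mod_cast hb
    have hp : (b ^ 2 + t ^ 2 : ℂ) ≠ 0 := by exact_mod_cast (hpos t).ne'
    have e1 : (1 + (t / b) ^ 2 : ℂ) = (b ^ 2 + t ^ 2) / b ^ 2 := by field_simp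
    simp only [id, Pi.pow_apply]
    push_cast
    rw [e1]
    field_simp
    linear_combination ((t : ℂ) ^ 2) * I_sq
  have hc : Continuous fun t : ℝ => (b + t * I : ℂ)⁻¹ := by
    refine Continuous.inv₀ (by fun_prop) fun t => ofReal_add_mul_I_ne_zero hb t
  rw [intervalIntegral.integral_eq_sub_of_hasDerivAt (fun t _ => hd t)
    (hc.intervalIntegrable _ _), neg_div, Real.arctan_neg]
  push_cast
  rw [neg_sq]
  ring

theorem tendsto_integral_inv_of_pos {b : ℝ} (hb : 0 < b) :
    Tendsto (fun T : ℝ => ∫ t in (-T)..T, (b + t * I : ℂ)⁻¹) atTop (𝓝 Real.pi) := by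
  simp_rw [integral_inv_ofReal_add_mul_I hb.ne']
  have h : Tendsto (fun T : ℝ => 2 * Real.arctan (T / b)) atTop (𝓝 (2 * (Real.pi / 2))) :=
    ((tendsto_nhdsWithin_iff.1 Real.tendsto_arctan_atTop).1.comp
      (tendsto_id.atTop_div_const hb)).const_mul 2
  rw [mul_div_cancel₀ _ two_ne_zero] at h
  exact (Complex.continuous_ofReal.tendsto _).comp h

theorem tendsto_integral_inv_of_neg {b : ℝ} (hb : b < 0) :
    Tendsto (fun T : ℝ => ∫ t in (-T)..T, (b + t * I : ℂ)⁻¹) atTop (𝓝 (-Real.pi)) := by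
  have h := (tendsto_integral_inv_of_pos (neg_pos.2 hb)).neg
  refine h.congr fun T => ?_
  rw [integral_inv_ofReal_add_mul_I hb.ne, integral_inv_ofReal_add_mul_I (neg_pos.2 hb).ne',
    div_neg, Real.arctan_neg]
  push_cast
  ring

theorem integrable_exp_neg_mul_abs {δ : ℝ} (hδ : 0 < δ) :
    Integrable fun t : ℝ => Real.exp (-δ * |t|) := by
  rw [← integrableOn_univ, ← Set.Iic_union_Ioi (a := (0 : ℝ)), integrableOn_union]
  constructor
  · refine (integrableOn_exp_mul_Iic hδ 0).congr_fun (fun t ht => ?_) measurableSet_Iic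
    simp [abs_of_nonpos (Set.mem_Iic.1 ht)]
  · refine (integrableOn_exp_mul_Ioi (neg_lt_zero.2 hδ) 0).congr_fun (fun t ht => ?_)
      measurableSet_Ioi
    simp [abs_of_pos (Set.mem_Ioi.1 ht)]

theorem integrable_of_norm_le_exp {F : ℝ → ℂ} (hF : Continuous F) {M δ : ℝ} (hδ : 0 < δ)
    (hb : ∀ t : ℝ, 1 ≤ |t| → ‖F t‖ ≤ M * Real.exp (-δ * |t|)) : Integrable F := by
  obtain ⟨C, hC⟩ := (isCompact_Icc (a := (-1 : ℝ)) (b := 1)).exists_bound_of_continuousOn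
    hF.continuousOn
  have hM : 0 ≤ M := by
    have := (norm_nonneg _).trans (hb 1 (by simp))
    exact nonneg_of_mul_nonneg_left this (Real.exp_pos _)
  have hC0 : 0 ≤ C := (norm_nonneg _).trans (hC 0 (by simp))
  refine ((integrable_exp_neg_mul_abs hδ).const_mul (M + C * Real.exp δ)).mono'
    hF.aestronglyMeasurable (Eventually.of_forall fun t => ?_)
  rcases le_total 1 |t| with h | h
  · refine (hb t h).trans ?_
    gcongr
    have := Real.exp_pos δ
    nlinarith
  · have h1 := hC t (abs_le.1 h)
    have h2 : 1 ≤ Real.exp δ * Real.exp (-δ * |t|) := by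
      rw [← Real.exp_add]
      exact Real.one_le_exp (by nlinarith)
    have := Real.exp_pos (-δ * |t|)
    nlinarith [mul_le_mul_of_nonneg_left h2 hC0, mul_nonneg hM this.le]

/-- If `f` has a single pole, at `p`, in a vertical strip and decays exponentially there, then the
difference of the integrals of `f` along the two boundary lines is given by the residue at `p`. -/
theorem integral_line_sub_integral_line {f g : ℂ → ℂ} {U : Set ℂ} {σ₁ σ₂ p M δ : ℝ} (n : ℕ)
    (hUo : IsOpen U) (hg : DifferentiableOn ℂ g U) (hU : ∀ z : ℂ, σ₁ ≤ z.re → z.re ≤ σ₂ → z ∈ U)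
    (h1 : σ₁ < p) (h2 : p < σ₂)
    (hf : ∀ z : ℂ, σ₁ ≤ z.re → z.re ≤ σ₂ → z ≠ p → f z = g z / (z - p) ^ (n + 1))
    (hδ : 0 < δ)
    (hb : ∀ z : ℂ, σ₁ ≤ z.re → z.re ≤ σ₂ → 1 ≤ |z.im| → ‖f z‖ ≤ M * Real.exp (-δ * |z.im|)) :
    (∫ t : ℝ, f (σ₂ + t * I)) - ∫ t : ℝ, f (σ₁ + t * I) =
      2 * Real.pi * (iteratedDeriv n g p / n !) := by
  have h12 : σ₁ < σ₂ := h1.trans h2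
  have hpU : U ∈ 𝓝 (p : ℂ) := hUo.mem_nhds (hU p h1.le h2.le)
  set c : ℕ → ℂ := fun i => (Function.swap dslope (p : ℂ))^[i] g p with hc
  set R : ℂ → ℂ := (Function.swap dslope (p : ℂ))^[n + 1] g with hR
  have hRd : DifferentiableOn ℂ R U := differentiableOn_iterate_dslope hpU hg (n + 1)
  have hcn : c n = iteratedDeriv n g p / n ! :=
    iterate_dslope_apply_same (hg.analyticAt hpU) n
  -- `f = P + R` with `P` the principal part
  set P : ℂ → ℂ := fun z => ∑ j ∈ Finset.range (n + 1), c (n - j) * ((z - p) ^ (j + 1))⁻¹ with hP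
  have hfPR : ∀ z : ℂ, σ₁ ≤ z.re → z.re ≤ σ₂ → z ≠ p → f z = P z + R z := by
    intro z hz1 hz2 hzp
    have hz0 : z - p ≠ 0 := sub_ne_zero.2 hzp
    rw [hf z hz1 hz2 hzp, eq_sum_iterate_dslope g p (n + 1) z, add_div,
      mul_div_cancel_left₀ _ (pow_ne_zero _ hz0), Finset.sum_div, hP]
    congr 1
    rw [← Finset.sum_range_reflect]
    refine Finset.sum_congr rfl fun j hj => ?_
    have hj' : j ≤ n := Nat.lt_succ_iff.1 (Finset.mem_range.1 hj)
    simp only [Nat.add_sub_cancel]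
    have : (z - p) ^ (n + 1) = (z - p) ^ (n - j) * (z - p) ^ (j + 1) := by
      rw [← pow_add]; congr 1; omega
    rw [this, mul_comm, mul_div_mul_left _ _ (pow_ne_zero _ hz0),
      div_eq_mul_inv]
  have hne : ∀ b : ℝ, b ≠ p → ∀ t : ℝ, (b + t * I : ℂ) ≠ p := by
    intro b hb t h
    apply hb
    simpa using congrArg Complex.re h
  -- the integrals of `f` along the two lines
  have hfc : ∀ σ : ℝ, σ₁ ≤ σ → σ ≤ σ₂ → σ ≠ p → Continuous fun t : ℝ => f (σ + t * I) := by
    intro σ hσ1 hσ2 hσ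
    have : (fun t : ℝ => f (σ + t * I)) =
        fun t : ℝ => g (σ + t * I) / ((σ + t * I : ℂ) - p) ^ (n + 1) := by
      funext t
      exact hf _ (by simpa) (by simpa) (hne σ hσ t)
    rw [this]
    refine Continuous.div ?_ (by fun_prop) fun t => pow_ne_zero _ (sub_ne_zero.2 (hne σ hσ t))
    exact hg.continuousOn.comp_continuous (by fun_prop) fun t => hU _ (by simpa) (by simpa)
  have hfi : ∀ σ : ℝ, σ₁ ≤ σ → σ ≤ σ₂ → σ ≠ p → Integrable fun t : ℝ => f (σ + t * I) := by
    intro σ hσ1 hσ2 hσ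
    refine integrable_of_norm_le_exp (M := M) (hfc σ hσ1 hσ2 hσ) hδ fun t ht => ?_
    simpa using hb (σ + t * I) (by simpa) (by simpa) (by simpa)
  have hflim : ∀ σ : ℝ, σ₁ ≤ σ → σ ≤ σ₂ → σ ≠ p →
      Tendsto (fun T : ℝ => ∫ t in (-T)..T, f (σ + t * I)) atTop (𝓝 (∫ t : ℝ, f (σ + t * I))) :=
    fun σ a b c => intervalIntegral_tendsto_integral (hfi σ a b c) tendsto_neg_atTop_atBot
      tendsto_id
  -- the integrals of the principal part
  have hPc : ∀ σ : ℝ, σ ≠ p → ∀ j : ℕ,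
      Continuous fun t : ℝ => c (n - j) * (((σ + t * I : ℂ) - p) ^ (j + 1))⁻¹ := by
    intro σ hσ j
    refine continuous_const.mul (Continuous.inv₀ (by fun_prop) fun t => ?_)
    exact pow_ne_zero _ (sub_ne_zero.2 (hne σ hσ t))
  have hPlim : ∀ σ : ℝ, σ ≠ p → ∀ L : ℂ,
      Tendsto (fun T : ℝ => ∫ t in (-T)..T, ((σ - p : ℝ) + t * I : ℂ)⁻¹) atTop (𝓝 L) →
      Tendsto (fun T : ℝ => ∫ t in (-T)..T, P (σ + t * I)) atTop (𝓝 (c n * L)) := by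
    intro σ hσ L hL
    have e : ∀ T : ℝ, ∫ t in (-T)..T, P (σ + t * I) =
        ∑ j ∈ Finset.range (n + 1), c (n - j) *
          ∫ t in (-T)..T, (((σ - p : ℝ) + t * I : ℂ) ^ (j + 1))⁻¹ := by
      intro T
      rw [intervalIntegral.integral_finsetSum
        (fun j _ => (hPc σ hσ j).intervalIntegrable _ _)]
      refine Finset.sum_congr rfl fun j _ => ?_
      rw [intervalIntegral.integral_const_mul]
      congr 2
      funext t
      congr 2
      push_cast
      ring
    simp_rw [e, Finset.sum_range_succ' _ n]
    have h0 : Tendsto (fun T : ℝ => ∑ j ∈ Finset.range n, c (n - (j + 1)) *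
          ∫ t in (-T)..T, (((σ - p : ℝ) + t * I : ℂ) ^ (j + 1 + 1))⁻¹) atTop (𝓝 0) := by
      rw [← Finset.sum_const_zero (s := Finset.range n)]
      refine tendsto_finsetSum _ fun j _ => ?_
      simpa using (tendsto_integral_inv_pow (sub_ne_zero.2 hσ) j).const_mul (c (n - (j + 1)))
    simpa using h0.add (hL.const_mul (c n))
  have hP2 := hPlim σ₂ h2.ne' _ (tendsto_integral_inv_of_pos (sub_pos.2 h2))
  have hP1 := hPlim σ₁ h1.ne _ (tendsto_integral_inv_of_neg (sub_neg.2 h1))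
  -- the horizontal sides
  have hRb : ∀ ε > 0, ∀ᶠ T : ℝ in atTop, ∀ z : ℂ, σ₁ ≤ z.re → z.re ≤ σ₂ → |z.im| = T →
      ‖R z‖ ≤ ε := by
    intro ε hε
    -- On the horizontal sides R = f - P, where f decays exponentially and P is O(1/T).
    have hlim : Tendsto (fun T : ℝ => M * Real.exp (-δ * T) +
        ∑ j ∈ Finset.range (n + 1), ‖c (n - j)‖ * (T ^ (j + 1))⁻¹) atTop (𝓝 0) := by
      have a1 : Tendsto (fun T : ℝ => M * Real.exp (-δ * T)) atTop (𝓝 (M * 0)) := by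
        refine (Real.tendsto_exp_atBot.comp ?_).const_mul M
        exact tendsto_id.const_mul_atTop_of_neg (neg_lt_zero.2 hδ)
      have a2 : Tendsto (fun T : ℝ => ∑ j ∈ Finset.range (n + 1),
          ‖c (n - j)‖ * (T ^ (j + 1))⁻¹) atTop
          (𝓝 (∑ j ∈ Finset.range (n + 1), ‖c (n - j)‖ * 0)) := by
        refine tendsto_finsetSum _ fun j _ => Tendsto.const_mul _ ?_
        exact (tendsto_pow_atTop (by omega)).inv_tendsto_atTop
      simpa using a1.add a2
    filter_upwards [hlim.eventually_lt_const hε, eventually_ge_atTop 1] with T hT hT1 z hz1 hz2 hzT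
    have hzp : z ≠ p := by
      rintro rfl
      simp at hzT
      linarith
    have : R z = f z - P z := by rw [hfPR z hz1 hz2 hzp]; ring
    rw [this]
    refine (norm_sub_le _ _).trans (le_trans (add_le_add ?_ ?_) hT.le)
    · simpa [hzT] using hb z hz1 hz2 (by rw [hzT]; exact hT1)
    · refine (norm_sum_le _ _).trans (Finset.sum_le_sum fun j _ => ?_)
      rw [norm_mul, norm_inv, norm_pow]
      have : T ≤ ‖z - p‖ := by
        rw [← hzT]; simpa using Complex.abs_im_le_norm (z - p)
      gcongr
  have hhor : ∀ s : ℝ → ℝ, (∀ T, |s T| = |T|) →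
      Tendsto (fun T : ℝ => ∫ x in σ₁..σ₂, R (x + s T * I)) atTop (𝓝 0) := by
    intro s hs
    rw [Metric.tendsto_nhds]
    intro ε hε
    have hε' : 0 < ε / (2 * (σ₂ - σ₁)) := div_pos hε (by linarith)
    filter_upwards [hRb _ hε', eventually_ge_atTop 0] with T hT hT0
    rw [dist_zero_right]
    have := intervalIntegral.norm_integral_le_of_norm_le_const (a := σ₁) (b := σ₂)
      (f := fun x : ℝ => R (x + s T * I)) (C := ε / (2 * (σ₂ - σ₁))) (fun x hx => by
        rw [Set.uIoc_of_le h12.le] at hx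
        exact hT _ (by simpa using hx.1.le) (by simpa using hx.2)
          (by simp [hs, abs_of_nonneg hT0]))
    refine this.trans_lt ?_
    rw [abs_of_pos (by linarith : 0 < σ₂ - σ₁)]
    have : σ₂ - σ₁ ≠ 0 := by linarith
    field_simp
    linarith
  -- Cauchy's theorem for `R`
  have hrect : ∀ T : ℝ, (∫ t in (-T)..T, R (σ₂ + t * I)) - (∫ t in (-T)..T, R (σ₁ + t * I)) =
      -I * ((∫ x in σ₁..σ₂, R (x + T * I)) - ∫ x in σ₁..σ₂, R (x + (-T : ℝ) * I)) := by
    intro T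
    have := Complex.integral_boundary_rect_eq_zero_of_differentiableOn R (σ₁ + (-T : ℝ) * I)
      (σ₂ + T * I) (hRd.mono fun z hz => by
        have := hz.1
        simp only [Set.mem_preimage, add_re, ofReal_re, mul_re, I_re, mul_zero, ofReal_im, I_im,
          mul_one, sub_self, add_zero, Set.uIcc_of_le h12.le] at this
        exact hU z this.1 this.2)
    simp only [add_re, ofReal_re, mul_re, I_re, mul_zero, ofReal_im, I_im, mul_one, sub_self,
      add_zero, add_im, mul_im, zero_add, smul_eq_mul] at this
    linear_combination (-I) * this + ((∫ t in (-T)..T, R (σ₂ + t * I)) -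
      (∫ t in (-T)..T, R (σ₁ + t * I))) * I_sq
  have hsplit : ∀ σ : ℝ, σ₁ ≤ σ → σ ≤ σ₂ → σ ≠ p → ∀ T : ℝ, ∫ t in (-T)..T, f (σ + t * I) =
      (∫ t in (-T)..T, P (σ + t * I)) + ∫ t in (-T)..T, R (σ + t * I) := by
    intro σ hσ1 hσ2 hσ T
    rw [← intervalIntegral.integral_add]
    · exact intervalIntegral.integral_congr fun t _ => hfPR _ (by simpa) (by simpa) (hne σ hσ t)
    · exact (continuous_finsetSum _ fun j _ => hPc σ hσ j).intervalIntegrable _ _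
    · exact (hRd.continuousOn.comp_continuous (by fun_prop)
        fun t => hU _ (by simpa) (by simpa)).intervalIntegrable _ _
  have hA := (hflim σ₂ h12.le le_rfl h2.ne').sub (hflim σ₁ le_rfl h12.le h1.ne)
  have hB := (hP2.sub hP1).add (((hhor (fun T => T) fun _ => rfl).sub
    (hhor (fun T => -T) fun T => abs_neg T)).const_mul (-I))
  have hAB := tendsto_nhds_unique hA (hB.congr fun T => by
    rw [← hrect T, hsplit σ₂ h12.le le_rfl h2.ne', hsplit σ₁ le_rfl h12.le h1.ne]
    ring)
  rw [hAB, hcn]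
  ring

/-! ### Exponential decay of Γ in vertical strips -/

theorem mellin_eq_integral_exp (f : ℝ → ℂ) (s : ℂ) :
    mellin f s = ∫ u : ℝ, Complex.exp (-s * u) * f (Real.exp (-u)) := by
  rw [mellin_eq_fourier, Real.fourier_real_eq_integral_exp_smul]
  refine integral_congr_ae (Eventually.of_forall fun u => ?_)
  have hπ : (Real.pi : ℂ) ≠ 0 := by exact_mod_cast Real.pi_ne_zero
  simp only [smul_eq_mul, Complex.real_smul]
  rw [← mul_assoc, Complex.ofReal_exp, ← Complex.exp_add]
  congr 2
  push_cast
  field_simp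
  conv_rhs => rw [← Complex.re_add_im s]
  ring

/-- After x = e^(-u) the Euler integrand is entire in u, so rotating the ray of integration becomes
translating a line. -/
theorem Complex.Gamma_eq_integral_exp {w : ℂ} (hw : 0 < w.re) :
    Complex.Gamma w = ∫ u : ℝ, Complex.exp (-w * u - Complex.exp (-u)) := by
  rw [Complex.Gamma_eq_integral hw, Complex.GammaIntegral_eq_mellin, mellin_eq_integral_exp]
  refine integral_congr_ae (Eventually.of_forall fun u => ?_)
  simp only
  rw [sub_eq_add_neg, Complex.exp_add]
  push_cast
  rfl

theorem integral_exp_sub_mul_exp {a c : ℝ} (ha : 0 < a) (hc : 0 < c) :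
    ∫ u : ℝ, Real.exp (-a * u - c * Real.exp (-u)) = (1 / c) ^ a * Real.Gamma a := by
  have h := mellin_eq_integral_exp (fun x => ((Real.exp (-(c * x)) : ℝ) : ℂ)) (a : ℂ)
  have h2 := Complex.integral_cpow_mul_exp_neg_mul_Ioi (a := (a : ℂ)) (r := c) (by simpa) hc
  have h3 : mellin (fun x => ((Real.exp (-(c * x)) : ℝ) : ℂ)) (a : ℂ) =
      (1 / c : ℂ) ^ (a : ℂ) * Complex.Gamma a := by
    rw [← h2, mellin]
    simp
  rw [h3] at h
  have h4 : (∫ u : ℝ, Complex.exp (-(a : ℂ) * u) * ((Real.exp (-(c * Real.exp (-u))) : ℝ) : ℂ)) =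
      ((∫ u : ℝ, Real.exp (-a * u - c * Real.exp (-u)) : ℝ) : ℂ) := by
    refine Eq.trans ?_ integral_ofReal
    refine integral_congr_ae (Eventually.of_forall fun u => ?_)
    change _ = ((Real.exp (-a * u - c * Real.exp (-u)) : ℝ) : ℂ)
    rw [sub_eq_add_neg, Real.exp_add]
    push_cast
    rfl
  rw [h4, Complex.Gamma_ofReal] at h
  have h5 : ((1 / c : ℂ)) ^ (a : ℂ) = (((1 / c) ^ a : ℝ) : ℂ) := by
    rw [Complex.ofReal_cpow (by positivity)]
    push_cast
    rfl
  rw [h5] at h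
  exact_mod_cast h.symm

theorem norm_exp_rotated (w : ℂ) (z : ℂ) :
    ‖Complex.exp (I * w * z - Complex.exp (I * z))‖ =
      Real.exp (-w.re * z.im - w.im * z.re - Real.exp (-z.im) * Real.cos z.re) := by
  rw [Complex.norm_exp]
  congr 1
  simp [Complex.exp_re]
  ring

/-- For t < 0 the bound e^(-t) ≥ t²/2 beats the linear term; completing the square gives the
constant 2a²/c. -/
theorem exp_neg_mul_sub_le {a c t : ℝ} (ha : 0 < a) (hc : 0 < c) :
    -a * t - c * Real.exp (-t) ≤ 2 * a ^ 2 / c - a * |t| := by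
  have hK : 0 ≤ 2 * a ^ 2 / c := by positivity
  rcases le_total 0 t with h | h
  · rw [abs_of_nonneg h]
    have : 0 < c * Real.exp (-t) := by positivity
    linarith
  · rw [abs_of_nonpos h]
    have h1 := Real.quadratic_le_exp_of_nonneg (neg_nonneg.2 h)
    have h2 : c * (t ^ 2 / 2) ≤ c * Real.exp (-t) := by
      gcongr
      nlinarith
    have h3 : -2 * a * t ≤ c * (t ^ 2 / 2) + 2 * a ^ 2 / c := by
      have : c * (t ^ 2 / 2) + 2 * a ^ 2 / c + 2 * a * t = (c * t + 2 * a) ^ 2 / (2 * c) := by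
        field_simp
        ring
      have h4 : 0 ≤ (c * t + 2 * a) ^ 2 / (2 * c) := by positivity
      linarith
    linarith

/-- Rotation of the line of integration in the (logarithmic) Euler integral. -/
theorem integral_exp_rotated {w : ℂ} (hw : 0 < w.re) {θ : ℝ} (h0 : 0 < θ) (hθ : θ < Real.pi / 2)
    {σ₁ σ₂ : ℝ} (h1 : -θ ≤ σ₁) (h2 : σ₂ ≤ θ) (h12 : σ₁ < σ₂) :
    (∫ t : ℝ, Complex.exp (I * w * (σ₂ + t * I) - Complex.exp (I * (σ₂ + t * I)))) =
      ∫ t : ℝ, Complex.exp (I * w * (σ₁ + t * I) - Complex.exp (I * (σ₁ + t * I))) := by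
  -- There is no pole in the strip: the residue theorem is applied at an arbitrary point p with g =
  -- (z - p) f, whose value at p is 0.
  set p : ℝ := (σ₁ + σ₂) / 2 with hp
  set f : ℂ → ℂ := fun z => Complex.exp (I * w * z - Complex.exp (I * z)) with hf
  have hc : 0 < Real.cos θ := Real.cos_pos_of_mem_Ioo ⟨by linarith, hθ⟩
  have h := integral_line_sub_integral_line (f := f) (g := fun z => (z - p) * f z)
    (U := Set.univ) (σ₁ := σ₁) (σ₂ := σ₂) (p := p)
    (M := Real.exp (2 * w.re ^ 2 / Real.cos θ + |w.im| * θ)) (δ := w.re) 0 isOpen_univ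
    (by simp only [hf]; fun_prop) (fun _ _ _ => Set.mem_univ _) (by rw [hp]; linarith)
    (by rw [hp]; linarith)
    (fun z _ _ hz => by
      have : z - p ≠ 0 := sub_ne_zero.2 hz
      field_simp
      simp) hw
    (fun z hz1 hz2 _ => by
      rw [hf, norm_exp_rotated, ← Real.exp_add]
      refine Real.exp_le_exp.2 ?_
      have hz : |z.re| ≤ θ := abs_le.2 ⟨by linarith, by linarith⟩
      have h3 := exp_neg_mul_sub_le (t := z.im) hw hc
      have h4 : Real.cos θ ≤ Real.cos z.re := by
        rw [← Real.cos_abs z.re]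
        exact Real.cos_le_cos_of_nonneg_of_le_pi (abs_nonneg _) (by linarith) hz
      have h5 : Real.cos θ * Real.exp (-z.im) ≤ Real.exp (-z.im) * Real.cos z.re := by
        rw [mul_comm]; gcongr
      have h6 : -(w.im * z.re) ≤ |w.im| * θ := by
        refine (neg_le_abs _).trans ?_
        rw [abs_mul]; gcongr
      linarith)
  simp only [iteratedDeriv_zero, sub_self, zero_mul, zero_div, mul_zero] at h
  exact sub_eq_zero.1 h

theorem norm_Gamma_le_of_rotated {w : ℂ} {σ θ : ℝ} (hw : 0 < w.re) (h0 : 0 < θ)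
    (hθ : θ < Real.pi / 2) (hσ : Real.cos σ = Real.cos θ)
    (h : Complex.Gamma w =
      ∫ t : ℝ, Complex.exp (I * w * (σ + t * I) - Complex.exp (I * (σ + t * I)))) :
    ‖Complex.Gamma w‖ ≤
      (1 / Real.cos θ) ^ w.re * Real.Gamma w.re * Real.exp (-(w.im * σ)) := by
  have hc : 0 < Real.cos θ := Real.cos_pos_of_mem_Ioo ⟨by linarith, hθ⟩
  rw [h]
  refine (norm_integral_le_integral_norm _).trans (le_of_eq ?_)
  rw [← integral_exp_sub_mul_exp hw hc, ← integral_mul_const]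
  refine integral_congr_ae (Eventually.of_forall fun t => ?_)
  simp only
  rw [norm_exp_rotated, ← Real.exp_add]
  simp [hσ]
  ring

/-- Rotation by σ = ±θ, with the sign of Im w, makes |e^(iwz)| contribute e^(-θ|Im w|); the
remaining real integral is a rescaled Γ(Re w). -/
theorem norm_Gamma_le {w : ℂ} {θ : ℝ} (hw : 0 < w.re) (h0 : 0 < θ) (hθ : θ < Real.pi / 2) :
    ‖Complex.Gamma w‖ ≤
      (1 / Real.cos θ) ^ w.re * Real.Gamma w.re * Real.exp (-θ * |w.im|) := by
  have hG : Complex.Gamma w =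
      ∫ t : ℝ, Complex.exp (I * w * ((0 : ℝ) + t * I) - Complex.exp (I * ((0 : ℝ) + t * I))) := by
    rw [Complex.Gamma_eq_integral_exp hw]
    refine integral_congr_ae (Eventually.of_forall fun t => ?_)
    simp only
    congr 2
    · push_cast
      linear_combination (-w * t) * I_sq
    · push_cast
      congr 1
      linear_combination (-t : ℂ) * I_sq
  rcases le_total 0 w.im with h | h
  · have := norm_Gamma_le_of_rotated hw h0 hθ rfl
      (hG.trans (integral_exp_rotated hw h0 hθ (by linarith) le_rfl h0).symm)
    rwa [abs_of_nonneg h, show -θ * w.im = -(w.im * θ) by ring]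
  · have := norm_Gamma_le_of_rotated (σ := -θ) hw h0 hθ (Real.cos_neg θ)
      (hG.trans (integral_exp_rotated hw h0 hθ le_rfl (by linarith) (by linarith)))
    rwa [abs_of_nonpos h, show -θ * -w.im = -(w.im * -θ) by ring]

/-- Exponential decay of `Γ` in vertical strips, with any rate less than `π / 2`. -/
theorem exists_norm_Gamma_le {θ a b : ℝ} (h0 : 0 < θ) (hθ : θ < Real.pi / 2) (ha : 0 < a) :
    ∃ C : ℝ, 0 ≤ C ∧ ∀ w : ℂ, a ≤ w.re → w.re ≤ b →
      ‖Complex.Gamma w‖ ≤ C * Real.exp (-θ * |w.im|) := by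
  have hc : 0 < Real.cos θ := Real.cos_pos_of_mem_Ioo ⟨by linarith, hθ⟩
  have hcont : ContinuousOn (fun x : ℝ => (1 / Real.cos θ) ^ x * Real.Gamma x) (Set.Icc a b) := by
    refine ContinuousOn.mul ?_ ?_
    · exact (Real.continuous_const_rpow (by positivity)).continuousOn
    · intro x hx
      refine (Real.differentiableAt_Gamma fun m => ?_).continuousAt.continuousWithinAt
      have : (0 : ℝ) ≤ m := Nat.cast_nonneg m
      linarith [hx.1]
  obtain ⟨C, hC⟩ := isCompact_Icc.exists_bound_of_continuousOn hcont
  refine ⟨max C 0, le_max_right _ _, fun w h1 h2 => ?_⟩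
  refine (norm_Gamma_le (ha.trans_le h1) h0 hθ).trans ?_
  gcongr
  exact (le_abs_self _).trans ((hC _ ⟨h1, h2⟩).trans (le_max_left _ _))

/-! ### Bounds for the cosine -/

theorem Complex.norm_cos_le_exp (z : ℂ) : ‖Complex.cos z‖ ≤ Real.exp |z.im| := by
  rw [Complex.cos, norm_div, Complex.norm_two, div_le_iff₀ two_pos]
  refine (norm_add_le _ _).trans ?_
  rw [Complex.norm_exp, Complex.norm_exp]
  have h1 : Real.exp (z * I).re ≤ Real.exp |z.im| :=
    Real.exp_le_exp.2 (by simpa using neg_le_abs z.im)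
  have h2 : Real.exp (-z * I).re ≤ Real.exp |z.im| :=
    Real.exp_le_exp.2 (by simpa using le_abs_self z.im)
  linarith

theorem Complex.exp_le_norm_cos {z : ℂ} (hz : 1 ≤ |z.im|) :
    Real.exp |z.im| / 4 ≤ ‖Complex.cos z‖ := by
  have key : Real.exp |z.im| - Real.exp (-|z.im|) ≤ 2 * ‖Complex.cos z‖ := by
    have e : 2 * ‖Complex.cos z‖ = ‖Complex.exp (z * I) + Complex.exp (-z * I)‖ := by
      rw [Complex.cos, norm_div, Complex.norm_two]; ring
    rw [e]
    have h1 : ‖Complex.exp (z * I)‖ = Real.exp (-z.im) := by simp [Complex.norm_exp]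
    have h2 : ‖Complex.exp (-z * I)‖ = Real.exp z.im := by simp [Complex.norm_exp]
    have h3 := norm_sub_le_norm_add (Complex.exp (z * I)) (Complex.exp (-z * I))
    have h4 := norm_sub_le_norm_add (Complex.exp (-z * I)) (Complex.exp (z * I))
    rw [add_comm] at h4
    rw [h1, h2] at h3 h4
    rcases abs_cases z.im with ⟨h, _⟩ | ⟨h, _⟩ <;> rw [h] <;> (try rw [neg_neg]) <;> linarith
  have h1 : 2 ≤ Real.exp |z.im| := by
    have := Real.add_one_le_exp |z.im|
    linarith
  have h2 : Real.exp (-|z.im|) ≤ 1 := Real.exp_le_one_iff.2 (by simp)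
  linarith

/-! ### Growth of ζ in vertical strips -/

/-- The summands of a series for `(s - 1) ζ(s) - 1`. -/
noncomputable def zetaSlope (n : ℕ) (s : ℂ) : ℂ :=
  (s - 1) * (n + 1 : ℂ) ^ (-s) + ((n + 2 : ℂ) ^ (1 - s) - (n + 1 : ℂ) ^ (1 - s))

theorem hasDerivAt_ofReal_cpow {x : ℝ} (hx : 0 < x) (r : ℂ) :
    HasDerivAt (fun y : ℝ => (y : ℂ) ^ r) (r * (x : ℂ) ^ (r - 1)) x := by
  have := ((hasDerivAt_id (x : ℂ)).cpow_const (c := r) (Or.inl (by simpa using hx))).comp_ofReal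
  simpa using this

/-- With N = n + 1, the summand is (1 - s) ∫ (x^(-s) - N^(-s)) dx over [N, N+1]. Two mean value
estimates gain one power of N, which gives convergence for Re s > 0. -/
theorem norm_zetaSlope_le {s : ℂ} (hs : 0 < s.re) (n : ℕ) :
    ‖zetaSlope n s‖ ≤ ‖s - 1‖ * ‖s‖ * (n + 1 : ℝ) ^ (-s.re - 1) := by
  set N : ℝ := n + 1 with hN
  have hN0 : 0 < N := by positivity
  have h1 : ∀ x ∈ Set.Icc N (N + 1),
      ‖(x : ℂ) ^ (-s) - (N : ℂ) ^ (-s)‖ ≤ ‖s‖ * N ^ (-s.re - 1) := by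
    intro x hx
    have := norm_image_sub_le_of_norm_deriv_le_segment' (a := N) (b := N + 1)
      (f := fun y : ℝ => (y : ℂ) ^ (-s)) (f' := fun y : ℝ => -s * (y : ℂ) ^ (-s - 1))
      (C := ‖s‖ * N ^ (-s.re - 1))
      (fun y hy => (hasDerivAt_ofReal_cpow (hN0.trans_le hy.1) (-s)).hasDerivWithinAt)
      (fun y hy => by
        rw [norm_mul, norm_neg, Complex.norm_cpow_eq_rpow_re_of_pos (hN0.trans_le hy.1)]
        gcongr
        exact Real.rpow_le_rpow_of_nonpos hN0 hy.1 (by simp; linarith)) x hx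
    refine this.trans (mul_le_of_le_one_right (by positivity) (by linarith [hx.2]))
  have h2 := norm_image_sub_le_of_norm_deriv_le_segment' (a := N) (b := N + 1)
      (f := fun y : ℝ => (s - 1) * (N : ℂ) ^ (-s) * (y : ℂ) + (y : ℂ) ^ (1 - s))
      (f' := fun y : ℝ => (s - 1) * (N : ℂ) ^ (-s) * 1 + (1 - s) * (y : ℂ) ^ (1 - s - 1))
      (C := ‖s - 1‖ * (‖s‖ * N ^ (-s.re - 1)))
      (fun y hy => ((((Complex.ofRealCLM.hasDerivAt (x := y)).const_mul _).add
        (hasDerivAt_ofReal_cpow (hN0.trans_le hy.1) (1 - s))).hasDerivWithinAt))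
      (fun y hy => by
        have : (s - 1) * (N : ℂ) ^ (-s) * 1 + (1 - s) * (y : ℂ) ^ (1 - s - 1) =
            (1 - s) * ((y : ℂ) ^ (-s) - (N : ℂ) ^ (-s)) := by
          rw [show 1 - s - 1 = -s by ring]; ring
        rw [this, norm_mul, norm_sub_rev]
        gcongr
        exact h1 y ⟨hy.1, hy.2.le⟩) (N + 1) ⟨by linarith, le_rfl⟩
  rw [add_sub_cancel_left, mul_one, ← mul_assoc] at h2
  refine le_trans (le_of_eq ?_) h2
  congr 1
  rw [zetaSlope, hN]
  push_cast
  rw [show (n : ℂ) + 1 + 1 = n + 2 by ring]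
  ring

theorem summable_add_one_rpow {a : ℝ} (ha : a < -1) : Summable fun n : ℕ => (n + 1 : ℝ) ^ a := by
  have := (summable_nat_add_iff 1).2 (Real.summable_nat_rpow.2 ha)
  simpa using this

theorem sum_zetaSlope (s : ℂ) (N : ℕ) : ∑ n ∈ Finset.range N, zetaSlope n s =
    (s - 1) * (∑ n ∈ Finset.range N, 1 / (n + 1 : ℂ) ^ s) + (N + 1 : ℂ) ^ (1 - s) - 1 := by
  induction N with
  | zero => simp
  | succ N ih =>
    rw [Finset.sum_range_succ, ih, Finset.sum_range_succ, zetaSlope, Complex.cpow_neg]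
    push_cast
    rw [show (N : ℂ) + 1 + 1 = N + 2 by ring]
    ring

theorem hasSum_zetaSlope {s : ℂ} (hs : 1 < s.re) :
    HasSum (fun n => zetaSlope n s) ((s - 1) * riemannZeta s - 1) := by
  have hsum : Summable fun n => zetaSlope n s :=
    Summable.of_norm_bounded ((summable_add_one_rpow (by linarith)).mul_left _)
      (norm_zetaSlope_le (by linarith))
  have hz : Summable fun n : ℕ => 1 / (n + 1 : ℂ) ^ s := by
    have := (summable_nat_add_iff 1).2 (Complex.summable_one_div_nat_cpow.2 hs)
    simpa using this
  have h1 := hz.hasSum.tendsto_sum_nat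
  rw [← zeta_eq_tsum_one_div_nat_add_one_cpow hs] at h1
  have h2 : Tendsto (fun N : ℕ => (N + 1 : ℂ) ^ (1 - s)) atTop (𝓝 0) := by
    rw [tendsto_zero_iff_norm_tendsto_zero]
    have : ∀ N : ℕ, ‖(N + 1 : ℂ) ^ (1 - s)‖ = (N + 1 : ℝ) ^ (-(s.re - 1)) := by
      intro N
      have := Complex.norm_cpow_eq_rpow_re_of_pos (x := N + 1) (by positivity) (1 - s)
      push_cast at this
      rw [this]
      simp
    simp_rw [this]
    exact (tendsto_rpow_neg_atTop (by linarith)).comp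
      (tendsto_atTop_add_const_right _ _ tendsto_natCast_atTop_atTop)
  have h3 := ((h1.const_mul (s - 1)).add h2).sub_const 1
  simp_rw [← sum_zetaSlope] at h3
  rw [add_zero] at h3
  rw [← tendsto_nhds_unique hsum.hasSum.tendsto_sum_nat h3]
  exact hsum.hasSum

/-- Since |s - 1| ≤ |s + 1| here, division by s(s + 1) makes the bound independent of s, as the
Weierstrass test requires. -/
theorem norm_zetaSlope_div_le {s : ℂ} (hs : 1 / 4 < s.re) (n : ℕ) :
    ‖zetaSlope n s / (s * (s + 1))‖ ≤ (n + 1 : ℝ) ^ (-5 / 4 : ℝ) := by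
  have h0 : 0 < ‖s‖ := norm_pos_iff.2 (by rintro rfl; norm_num at hs)
  have h1 : 0 < ‖s + 1‖ := by
    refine norm_pos_iff.2 fun h => ?_
    have := congrArg Complex.re h
    simp at this
    linarith
  have h2 : ‖s - 1‖ ≤ ‖s + 1‖ := by
    rw [← sq_le_sq₀ (norm_nonneg _) (norm_nonneg _), Complex.sq_norm, Complex.sq_norm,
      Complex.normSq_apply, Complex.normSq_apply]
    simp
    nlinarith
  rw [norm_div, norm_mul, div_le_iff₀ (by positivity)]
  refine (norm_zetaSlope_le (by linarith) n).trans ?_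
  have h3 : (n + 1 : ℝ) ^ (-s.re - 1) ≤ (n + 1 : ℝ) ^ (-5 / 4 : ℝ) :=
    Real.rpow_le_rpow_of_exponent_le (by simp) (by linarith)
  calc ‖s - 1‖ * ‖s‖ * (n + 1 : ℝ) ^ (-s.re - 1)
      ≤ ‖s + 1‖ * ‖s‖ * (n + 1 : ℝ) ^ (-5 / 4 : ℝ) := by gcongr
    _ = _ := by ring

/-- The series represents (s - 1)ζ(s) - 1 for Re s > 1 and is holomorphic for Re s > 1/4, so the
identity theorem carries the representation, and with it the quadratic bound, to the larger
half-plane. -/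
theorem norm_riemannZeta₁_sub_one_le {s : ℂ} (hs : 1 / 4 < s.re) :
    ‖riemannZeta₁ s - 1‖ ≤ ‖s‖ * ‖s + 1‖ * ∑' n : ℕ, (n + 1 : ℝ) ^ (-5 / 4 : ℝ) := by
  have hsum : Summable fun n : ℕ => (n + 1 : ℝ) ^ (-5 / 4 : ℝ) :=
    summable_add_one_rpow (by norm_num)
  set U : Set ℂ := {z : ℂ | 1 / 4 < z.re} with hU
  have hUo : IsOpen U := isOpen_lt continuous_const Complex.continuous_re
  have hne : ∀ z ∈ U, z * (z + 1) ≠ 0 := by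
    intro z hz h
    rcases mul_eq_zero.1 h with h | h <;>
    · have := congrArg Complex.re h
      simp at this
      have : 1 / 4 < z.re := hz
      linarith
  have hd : DifferentiableOn ℂ (fun z => ∑' n, zetaSlope n z / (z * (z + 1))) U := by
    refine differentiableOn_tsum_of_summable_norm hsum (fun n => ?_) hUo
      fun n z hz => norm_zetaSlope_div_le hz n
    refine DifferentiableOn.div ?_ (by fun_prop) hne
    have e1 : (n + 1 : ℂ) ≠ 0 := by exact_mod_cast n.succ_ne_zero
    have e2 : (n + 2 : ℂ) ≠ 0 := by exact_mod_cast (n + 1).succ_ne_zero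
    unfold zetaSlope
    refine Differentiable.differentiableOn ?_
    have a1 : Differentiable ℂ fun z : ℂ => (n + 1 : ℂ) ^ (-z) :=
      differentiable_id.neg.const_cpow (Or.inl e1)
    have a2 : Differentiable ℂ fun z : ℂ => (n + 1 : ℂ) ^ (1 - z) :=
      (differentiable_id.const_sub 1).const_cpow (Or.inl e1)
    have a3 : Differentiable ℂ fun z : ℂ => (n + 2 : ℂ) ^ (1 - z) :=
      (differentiable_id.const_sub 1).const_cpow (Or.inl e2)
    exact ((differentiable_id.sub_const 1).mul a1).add (a3.sub a2)
  have hd2 : DifferentiableOn ℂ (fun z => (riemannZeta₁ z - 1) / (z * (z + 1))) U :=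
    DifferentiableOn.div (by fun_prop) (by fun_prop) hne
  have heq : ∀ z : ℂ, 1 < z.re →
      (riemannZeta₁ z - 1) / (z * (z + 1)) = ∑' n, zetaSlope n z / (z * (z + 1)) := by
    intro z hz
    have hz1 : z - 1 ≠ 0 := sub_ne_zero.2 (by rintro rfl; simp at hz)
    rw [tsum_div_const, (hasSum_zetaSlope hz).tsum_eq,
      riemannZeta_eq_inv_sub_mul (sub_ne_zero.1 hz1), mul_inv_cancel_left₀ hz1]
  have h := (hd2.analyticOnNhd hUo).eqOn_of_preconnected_of_eventuallyEq (hd.analyticOnNhd hUo)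
    (convex_halfSpace_re_gt _).isPreconnected (z₀ := 2) (by simp [hU]; norm_num)
    (by
      filter_upwards [(isOpen_lt continuous_const Complex.continuous_re).mem_nhds
        (show (2 : ℂ) ∈ {z : ℂ | 1 < z.re} by simp)] with z hz using heq z hz)
  have h2 := h (show s ∈ U from hs)
  simp only at h2
  have h3 : ‖(riemannZeta₁ s - 1) / (s * (s + 1))‖ ≤ ∑' n : ℕ, (n + 1 : ℝ) ^ (-5 / 4 : ℝ) := by
    rw [h2]
    exact tsum_of_norm_bounded hsum.hasSum (norm_zetaSlope_div_le hs)
  rw [norm_div, norm_mul, div_le_iff₀] at h3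
  · linarith
  · rw [← norm_mul]; exact norm_pos_iff.2 (hne s hs)

theorem exists_norm_riemannZeta_le_of_half_le {ε : ℝ} (hε : 0 < ε) :
    ∃ C : ℝ, 0 ≤ C ∧ ∀ s : ℂ, 1 / 2 ≤ s.re → s.re ≤ 5 / 2 → 1 ≤ |s.im| →
      ‖riemannZeta s‖ ≤ C * Real.exp (ε * |s.im|) := by
  set B : ℝ := ∑' n : ℕ, (n + 1 : ℝ) ^ (-5 / 4 : ℝ) with hB
  have hB0 : 0 ≤ B := tsum_nonneg fun n => by positivity
  refine ⟨1 + (32 + 4 / ε ^ 2) * B, by positivity, fun s h1 h2 h3 => ?_⟩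
  have hn : ∀ z : ℂ, |z.re| ≤ 4 → ‖z‖ ≤ 4 + |z.im| := fun z hz =>
    (Complex.norm_le_abs_re_add_abs_im z).trans (by linarith)
  have hs1 : 1 ≤ ‖s - 1‖ := h3.trans (by simpa using Complex.abs_im_le_norm (s - 1))
  have hs : s ≠ 1 := by rintro rfl; simp at h3; linarith
  have hz : ‖riemannZeta s‖ ≤ ‖riemannZeta₁ s‖ := by
    rw [riemannZeta_eq_inv_sub_mul hs, norm_mul, norm_inv]
    exact mul_le_of_le_one_left (norm_nonneg _) (inv_le_one_of_one_le₀ hs1)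
  have h4 := norm_riemannZeta₁_sub_one_le (s := s) (by linarith)
  rw [← hB] at h4
  have h5 : ‖riemannZeta₁ s‖ ≤ 1 + ‖s‖ * ‖s + 1‖ * B := by
    have := norm_add_le (riemannZeta₁ s - 1) 1
    rw [sub_add_cancel, norm_one] at this
    linarith
  have h6 : ‖s‖ * ‖s + 1‖ ≤ (4 + |s.im|) * (4 + |s.im|) := by
    gcongr
    · exact hn s (abs_le.2 ⟨by linarith, by linarith⟩)
    · simpa using hn (s + 1) (abs_le.2 ⟨by simp; linarith, by simp; linarith⟩)
  set T := |s.im| with hT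
  have h7 := Real.quadratic_le_exp_of_nonneg (x := ε * T) (by positivity)
  have h8 : (4 + T) * (4 + T) ≤ (32 + 4 / ε ^ 2) * Real.exp (ε * T) := by
    have e1 : 1 ≤ Real.exp (ε * T) := Real.one_le_exp (by positivity)
    have e2 : 4 / ε ^ 2 * ((ε * T) ^ 2 / 2) ≤ 4 / ε ^ 2 * Real.exp (ε * T) := by
      gcongr
      have : 0 ≤ ε * T := by positivity
      linarith
    have e3 : 4 / ε ^ 2 * ((ε * T) ^ 2 / 2) = 2 * T ^ 2 := by field_simp; ring
    nlinarith [sq_nonneg (T - 4)]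
  have h9 : 1 ≤ Real.exp (ε * T) := Real.one_le_exp (by positivity)
  calc ‖riemannZeta s‖ ≤ 1 + ‖s‖ * ‖s + 1‖ * B := hz.trans h5
    _ ≤ 1 * Real.exp (ε * T) + ((32 + 4 / ε ^ 2) * Real.exp (ε * T)) * B := by
      rw [one_mul]
      exact add_le_add h9 (mul_le_mul_of_nonneg_right (h6.trans h8) hB0)
    _ = _ := by ring

theorem norm_cos_pi_mul_div_two_le (w : ℂ) :
    ‖Complex.cos (Real.pi * w / 2)‖ ≤ Real.exp (Real.pi / 2 * |w.im|) := by
  refine (Complex.norm_cos_le_exp _).trans (le_of_eq ?_)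
  congr 1
  rw [show (Real.pi * w / 2 : ℂ) = ((Real.pi / 2 : ℝ) : ℂ) * w by push_cast; ring,
    Complex.im_ofReal_mul, abs_mul, abs_of_pos (by positivity)]

/-- Left of 1/2 the functional equation is used: the decay of Γ cancels the growth of the cosine up
to an arbitrarily small exponent. -/
theorem exists_norm_riemannZeta_le {ε : ℝ} (hε : 0 < ε) :
    ∃ C : ℝ, 0 ≤ C ∧ ∀ s : ℂ, -1 / 2 ≤ s.re → s.re ≤ 5 / 2 → 1 ≤ |s.im| →
      ‖riemannZeta s‖ ≤ C * Real.exp (ε * |s.im|) := by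
  -- One η is lost in the decay rate of Γ and one in ζ(1 - s), so 2η ≤ ε is needed; η ≤ 1/2 keeps
  -- π/2 - η positive.
  set η : ℝ := min ε 1 / 2 with hη
  have hη0 : 0 < η := by positivity
  have hη1 : η ≤ 1 / 2 := by rw [hη]; linarith [min_le_right ε 1]
  have hη2 : 2 * η ≤ ε := by rw [hη]; linarith [min_le_left ε 1]
  have hπ := Real.pi_gt_three
  obtain ⟨C₁, hC₁, h₁⟩ := exists_norm_riemannZeta_le_of_half_le hη0
  obtain ⟨C₂, hC₂, h₂⟩ := exists_norm_Gamma_le (θ := Real.pi / 2 - η) (a := 1 / 2) (b := 3 / 2)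
    (by linarith) (by linarith) (by norm_num)
  refine ⟨C₁ + 2 * C₂ * C₁, by positivity, fun s hs1 hs2 hs3 => ?_⟩
  have hT : 0 ≤ |s.im| := abs_nonneg _
  rcases le_total (1 / 2) s.re with h | h
  · refine (h₁ s h hs2 hs3).trans ?_
    gcongr
    · have : 0 ≤ 2 * C₂ * C₁ := by positivity
      linarith
    · linarith
  · set w : ℂ := 1 - s with hw
    have hwre : w.re = 1 - s.re := by simp [hw]
    have hwim : |w.im| = |s.im| := by simp [hw]
    have hw0 : ∀ n : ℕ, w ≠ -n := by
      intro n hn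
      rw [hn] at hwim
      simp at hwim
      rw [← hwim] at hs3
      norm_num at hs3
    have hw1 : w ≠ 1 := by
      intro hn
      rw [hn] at hwim
      simp at hwim
      rw [← hwim] at hs3
      norm_num at hs3
    have hfe := riemannZeta_one_sub hw0 hw1
    rw [show 1 - w = s by simp [hw]] at hfe
    have b1 : ‖(2 * Real.pi : ℂ) ^ (-w)‖ ≤ 1 := by
      have := Complex.norm_cpow_eq_rpow_re_of_pos (x := 2 * Real.pi) (by positivity) (-w)
      push_cast at this
      rw [this]
      exact Real.rpow_le_one_of_one_le_of_nonpos (by linarith) (by simp; linarith)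
    have b2 := h₂ w (by linarith) (by linarith)
    have b3 := norm_cos_pi_mul_div_two_le w
    have b4 := h₁ w (by linarith) (by linarith) (by rw [hwim]; exact hs3)
    rw [hwim] at b2 b3 b4
    rw [hfe]
    simp only [norm_mul, Complex.norm_two]
    calc 2 * ‖(2 * Real.pi : ℂ) ^ (-w)‖ * ‖Complex.Gamma w‖ * ‖Complex.cos (Real.pi * w / 2)‖ *
          ‖riemannZeta w‖
        ≤ 2 * 1 * (C₂ * Real.exp (-(Real.pi / 2 - η) * |s.im|)) *
          Real.exp (Real.pi / 2 * |s.im|) * (C₁ * Real.exp (η * |s.im|)) := by gcongr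
      _ = 2 * C₂ * C₁ * Real.exp (2 * η * |s.im|) := by
        rw [show 2 * η * |s.im| = -(Real.pi / 2 - η) * |s.im| + Real.pi / 2 * |s.im| +
          η * |s.im| by ring, Real.exp_add, Real.exp_add]
        ring
      _ ≤ _ := by
        gcongr
        linarith

/-! ### The Dirichlet series of `piltz` and termwise integration -/

/-- Splitting off the first factor shows that d_(k+1) is the Dirichlet convolution of 1 with d_k, so
its Dirichlet series gains one factor ζ. -/
theorem piltz_succ (k n : ℕ) :
    piltz (k + 1) n = ∑ p ∈ n.divisorsAntidiagonal, piltz k p.2 := by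
  unfold piltz
  rw [← Finset.card_sigma]
  refine Finset.card_nbij' (fun f => ⟨(f 0, ∏ i, Fin.tail f i), Fin.tail f⟩)
    (fun q => Fin.cons q.1.1 q.2) ?_ ?_ ?_ ?_
  · intro f hf
    have hf := Nat.mem_finMulAntidiag.1 hf
    rw [Fin.prod_univ_succ] at hf
    simp only [Finset.coe_sigma, Set.mem_sigma_iff, Finset.mem_coe, Nat.mem_divisorsAntidiagonal,
      Nat.mem_finMulAntidiag]
    refine ⟨hf, trivial, ?_⟩
    intro h0
    apply hf.2
    rw [← hf.1]
    exact mul_eq_zero_of_right _ h0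
  · rintro ⟨⟨a, b⟩, g⟩ hq
    simp only [Finset.coe_sigma, Set.mem_sigma_iff, Finset.mem_coe, Nat.mem_divisorsAntidiagonal,
      Nat.mem_finMulAntidiag] at hq
    simp only [Finset.mem_coe, Nat.mem_finMulAntidiag, Fin.prod_univ_succ, Fin.cons_zero,
      Fin.cons_succ]
    rw [hq.2.1]
    exact hq.1
  · intro f _
    exact Fin.cons_self_tail f
  · rintro ⟨⟨a, b⟩, g⟩ hq
    simp only [Finset.coe_sigma, Set.mem_sigma_iff, Finset.mem_coe, Nat.mem_divisorsAntidiagonal,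
      Nat.mem_finMulAntidiag] at hq
    simp [hq.2.1]

theorem LSeriesHasSum_piltz (k : ℕ) {s : ℂ} (hs : 1 < s.re) :
    LSeriesHasSum (fun n => (piltz k n : ℂ)) s (riemannZeta s ^ k) := by
  induction k with
  | zero =>
    have h : (fun n => (piltz 0 n : ℂ)) = LSeries.delta := by
      funext n
      rcases eq_or_ne n 1 with rfl | hn
      · simp [piltz, Nat.finMulAntidiag_one, LSeries.delta]
      · simp [piltz, Nat.finMulAntidiag_zero_left hn, LSeries.delta, hn]
    rw [h, pow_zero]
    have := LSeriesSummable.LSeriesHasSum (f := LSeries.delta) (s := s) (by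
      refine summable_of_ne_finset_zero (s := {1}) fun n hn => ?_
      simp only [Finset.mem_singleton] at hn
      simp [LSeries.term_delta, hn])
    rwa [LSeries_delta] at this
  | succ k ih =>
    have h1 : LSeriesHasSum 1 s (riemannZeta s) := LSeriesHasSum_one hs
    have h := h1.convolution ih
    rw [pow_succ']
    convert! h using 1
    rw [LSeries.convolution_def]
    funext n
    rw [piltz_succ]
    simp

theorem hasSum_piltz (k : ℕ) {s : ℂ} (hs : 1 < s.re) :
    HasSum (fun n : ℕ+ => (piltz k n : ℂ) * (n : ℂ) ^ (-s)) (riemannZeta s ^ k) := by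
  have h : HasSum _ _ := LSeriesHasSum_piltz k hs
  rw [← PNat.coe_injective.hasSum_iff] at h
  · refine h.congr_fun ?_
    intro n
    simp [LSeries.term, Complex.cpow_neg, div_eq_mul_inv]
  · intro n hn
    have : n = 0 := by
      by_contra h0
      exact hn ⟨⟨n, Nat.pos_of_ne_zero h0⟩, rfl⟩
    simp [this]

theorem PNat.norm_cpow (n : ℕ+) (s : ℂ) : ‖(n : ℂ) ^ s‖ = (n : ℝ) ^ s.re :=
  Complex.norm_natCast_cpow_of_pos n.pos s

theorem summable_piltz (k : ℕ) {a : ℝ} (ha : 1 < a) :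
    Summable fun n : ℕ+ => (piltz k n : ℝ) * (n : ℝ) ^ (-a) := by
  have := (hasSum_piltz k (s := (a : ℂ)) (by simpa)).summable.norm
  refine this.congr fun n => ?_
  simp [PNat.norm_cpow]

theorem continuous_riemannZeta_line {b : ℝ} (hb : b ≠ 1) :
    Continuous fun t : ℝ => riemannZeta (b + t * I) := by
  refine continuous_iff_continuousAt.2 fun t => ?_
  have : (b + t * I : ℂ) ≠ 1 := by
    intro h
    have := congrArg Complex.re h
    simp at this
    exact hb this
  exact ContinuousAt.comp (f := fun t : ℝ => (b + t * I : ℂ))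
    (differentiableAt_riemannZeta this).continuousAt (by fun_prop)

theorem integrable_mul_riemannZeta_pow {F : ℝ → ℂ} (hF : Integrable F) (k : ℕ) {b : ℝ}
    (hb : 1 < b) : Integrable fun t => F t * riemannZeta (b + t * I) ^ k := by
  refine hF.mul_bdd (c := ∑' n : ℕ+, (piltz k n : ℝ) * (n : ℝ) ^ (-b))
    ((continuous_riemannZeta_line hb.ne').pow k).aestronglyMeasurable
    (Eventually.of_forall fun t => ?_)
  have h := hasSum_piltz k (s := b + t * I) (by simpa)
  rw [← h.tsum_eq]
  refine tsum_of_norm_bounded (summable_piltz k hb).hasSum fun n => ?_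
  simp [PNat.norm_cpow]

/-- Termwise integration against the Dirichlet series of `ζ ^ k` on a vertical line. -/
theorem hasSum_integral_mul_piltz {F : ℝ → ℂ} (hF : Integrable F) (k : ℕ) {a r : ℝ}
    (h : 1 < a + r) :
    HasSum (fun n : ℕ+ => (piltz k n : ℂ) * (n : ℂ) ^ (-r : ℂ) *
        ∫ t : ℝ, F t * (n : ℂ) ^ (-(a + t * I) : ℂ))
      (∫ t : ℝ, F t * riemannZeta ((a + r : ℝ) + t * I) ^ k) := by
  have hn : ∀ n : ℕ+, ∀ t : ℝ, ‖(n : ℂ) ^ (-(a + t * I) : ℂ)‖ = (n : ℝ) ^ (-a) := by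
    intro n t
    simp [PNat.norm_cpow]
  have hn0 : ∀ n : ℕ+, (n : ℂ) ≠ 0 := fun n => by exact_mod_cast n.ne_zero
  have hint : ∀ n : ℕ+, Integrable fun t : ℝ => F t * (n : ℂ) ^ (-(a + t * I) : ℂ) := by
    intro n
    refine hF.mul_bdd (c := (n : ℝ) ^ (-a)) ?_ (Eventually.of_forall fun t => (hn n t).le)
    exact (Continuous.const_cpow (by fun_prop) (Or.inl (hn0 n))).aestronglyMeasurable
  have key := hasSum_integral_of_summable_integral_norm
    (F := fun (n : ℕ+) (t : ℝ) => (piltz k n : ℂ) * (n : ℂ) ^ (-r : ℂ) *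
      (F t * (n : ℂ) ^ (-(a + t * I) : ℂ))) (μ := volume) (fun n => (hint n).const_mul _) (by
      -- The modulus of n^(-(a+it)) does not depend on t, so the L¹ norms are those of an absolutely
      -- convergent Dirichlet series at a + r > 1.
      have e : ∀ n : ℕ+, ∫ t : ℝ, ‖(piltz k n : ℂ) * (n : ℂ) ^ (-r : ℂ) *
          (F t * (n : ℂ) ^ (-(a + t * I) : ℂ))‖ =
          (piltz k n : ℝ) * (n : ℝ) ^ (-(a + r)) * ∫ t : ℝ, ‖F t‖ := by
        intro n
        rw [← integral_const_mul]
        refine integral_congr_ae (Eventually.of_forall fun t => ?_)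
        simp only [norm_mul, hn, PNat.norm_cpow, Complex.norm_natCast]
        have hp : (0 : ℝ) < n := by exact_mod_cast n.pos
        rw [show -(a + r) = -r + -a by ring, Real.rpow_add hp]
        simp
        ring
      simp_rw [e]
      exact (summable_piltz k h).mul_right _)
  simp_rw [integral_const_mul] at key
  convert! key using 2
  funext t
  have h2 := (hasSum_piltz k (s := (a + r : ℝ) + t * I) (by simpa)).tsum_eq
  rw [← h2, ← tsum_mul_left]
  refine tsum_congr fun n => ?_
  rw [show (-(((a + r : ℝ) : ℂ) + t * I)) = -r + -(a + t * I) by push_cast; ring,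
    Complex.cpow_add _ _ (hn0 n)]
  ring

/-! ### The Meijer G-integrand in closed form -/

/-- The gamma quotient of the Mellin-Barnes integrand at `s = -w / 2`, in closed form. -/
noncomputable def gammaKernel (k : ℕ) (w : ℂ) : ℂ :=
  ((2 : ℂ) ^ (1 - w) * (Real.sqrt Real.pi : ℂ) * Complex.Gamma w) ^ k *
    (Complex.cos (Real.pi * w / 2) / Real.pi) ^ (k - 1)

theorem inv_Gamma_half_add {s : ℂ} (hs : s.re < 0) :
    (Complex.Gamma (1 / 2 + s))⁻¹ =
      Complex.Gamma (1 / 2 - s) * (Complex.cos (Real.pi * s) / Real.pi) := by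
  have hπ : (Real.pi : ℂ) ≠ 0 := by exact_mod_cast Real.pi_ne_zero
  have hG : Complex.Gamma (1 / 2 - s) ≠ 0 := Complex.Gamma_ne_zero_of_re_pos (by simp; linarith)
  have h := Complex.Gamma_mul_Gamma_one_sub (1 / 2 + s)
  rw [show 1 - (1 / 2 + s) = 1 / 2 - s by ring,
    show (Real.pi * (1 / 2 + s) : ℂ) = Real.pi * s + Real.pi / 2 by ring,
    Complex.sin_add_pi_div_two] at h
  rw [eq_div_of_mul_eq hG h]
  simp only [inv_div]
  field_simp

/-- Reflection turns each of the k - 1 denominators into a factor Γ(1/2 - s) and a cosine; the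
resulting k pairs Γ(-s)Γ(1/2 - s) collapse by duplication. -/
theorem gammaKernel_eq {k : ℕ} (hk : 1 ≤ k) {s : ℂ} (hs : s.re < 0) :
    Complex.Gamma (-s) ^ k * Complex.Gamma (1 / 2 - s) / Complex.Gamma (1 / 2 + s) ^ (k - 1) =
      gammaKernel k (-2 * s) := by
  obtain ⟨m, rfl⟩ := Nat.exists_eq_add_of_le' hk
  have h := Complex.Gamma_mul_Gamma_add_half (-s)
  rw [show -s + 1 / 2 = 1 / 2 - s by ring, show 2 * -s = -2 * s by ring] at h
  rw [gammaKernel, div_eq_mul_inv, ← inv_pow, inv_Gamma_half_add hs, Nat.add_sub_cancel,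
    show (2 : ℂ) ^ (1 - -2 * s) * (Real.sqrt Real.pi : ℂ) * Complex.Gamma (-2 * s) =
      Complex.Gamma (-s) * Complex.Gamma (1 / 2 - s) by rw [h]; ring,
    show (Real.pi * (-2 * s) / 2 : ℂ) = -(Real.pi * s) by ring, Complex.cos_neg]
  ring

theorem meijerGIntegrand_psiParams {k : ℕ} (hk : 1 ≤ k) (z : ℂ) {s : ℂ} (hs : s.re < 0) :
    meijerGIntegrand (k + 1) 0 [] (psiParams k) z s = gammaKernel k (-2 * s) * z ^ s := by
  have h1 : (psiParams k).take (k + 1) = List.replicate k 0 ++ [1 / 2] := by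
    rw [psiParams, List.take_append_of_le_length (by simp), List.take_of_length_le (by simp)]
  have h2 : (psiParams k).drop (k + 1) = List.replicate (k - 1) (1 / 2) := by
    rw [psiParams, List.drop_append_of_le_length (by simp), List.drop_of_length_le (by simp),
      List.nil_append]
  rw [meijerGIntegrand, h1, h2, ← gammaKernel_eq hk hs]
  simp only [List.map_append, List.map_replicate, List.prod_append, List.prod_replicate,
    List.map_cons, List.map_nil, List.prod_cons, List.prod_nil, List.take_nil, List.drop_nil,
    mul_one, zero_sub]
  norm_num

theorem differentiableAt_Gamma_of_re_pos {s : ℂ} (hs : 0 < s.re) :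
    DifferentiableAt ℂ Complex.Gamma s := by
  refine Complex.differentiableAt_Gamma s fun m hm => ?_
  rw [hm] at hs
  simp at hs
  linarith [Nat.cast_nonneg (α := ℝ) m]

theorem differentiableAt_gammaKernel (k : ℕ) {w : ℂ} (hw : 0 < w.re) :
    DifferentiableAt ℂ (gammaKernel k) w := by
  have h1 := differentiableAt_Gamma_of_re_pos hw
  have h2 : DifferentiableAt ℂ (fun w : ℂ => (2 : ℂ) ^ (1 - w)) w :=
    (differentiableAt_id.const_sub 1).const_cpow (Or.inl two_ne_zero)
  unfold gammaKernel
  exact (((h2.mul_const _).mul h1).pow k).mul (by fun_prop)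

theorem exists_norm_gammaKernel_le {k : ℕ} (hk : 1 ≤ k) {a b : ℝ} (ha : 0 < a) :
    ∃ M : ℝ, 0 ≤ M ∧ ∀ w : ℂ, a ≤ w.re → w.re ≤ b →
      ‖gammaKernel k w‖ ≤ M * Real.exp (-(1 / 2) * |w.im|) := by
  have hπ := Real.pi_gt_three
  have hk0 : (0 : ℝ) < k := by exact_mod_cast hk
  have hk1 : 1 / (k : ℝ) ≤ 1 := by
    rw [div_le_one hk0]; exact_mod_cast hk
  have hk2 : 0 < 1 / (k : ℝ) := by positivity
  -- With this rate, k gamma factors against k - 1 cosines leave the exponent 1 - π/2 < -1/2.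
  obtain ⟨C, hC, h⟩ := exists_norm_Gamma_le (θ := Real.pi / 2 - 1 / k) (a := a) (b := b)
    (by linarith) (by linarith) ha
  refine ⟨(2 * Real.sqrt Real.pi * C) ^ k, by positivity, fun w h1 h2 => ?_⟩
  have b1 : ‖(2 : ℂ) ^ (1 - w)‖ ≤ 2 := by
    have := Complex.norm_cpow_eq_rpow_re_of_pos (x := 2) two_pos (1 - w)
    push_cast at this
    rw [this]
    have h3 := Real.rpow_le_rpow_of_exponent_le (x := 2) (by norm_num)
      (show 1 - w.re ≤ 1 by linarith)
    simpa using h3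
  have b2 := h w h1 h2
  have b3 : ‖Complex.cos (Real.pi * w / 2) / Real.pi‖ ≤ Real.exp (Real.pi / 2 * |w.im|) := by
    rw [norm_div]
    refine (div_le_self (norm_nonneg _) ?_).trans (norm_cos_pi_mul_div_two_le w)
    rw [Complex.norm_of_nonneg Real.pi_pos.le]
    linarith
  have b4 : ‖(Real.sqrt Real.pi : ℂ)‖ = Real.sqrt Real.pi :=
    Complex.norm_of_nonneg (Real.sqrt_nonneg _)
  rw [gammaKernel, norm_mul, norm_pow, norm_pow, norm_mul, norm_mul, b4]
  have hT : 0 ≤ |w.im| := abs_nonneg _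
  calc (‖(2 : ℂ) ^ (1 - w)‖ * Real.sqrt Real.pi * ‖Complex.Gamma w‖) ^ k *
        ‖Complex.cos (Real.pi * w / 2) / Real.pi‖ ^ (k - 1)
      ≤ (2 * Real.sqrt Real.pi * (C * Real.exp (-(Real.pi / 2 - 1 / k) * |w.im|))) ^ k *
        Real.exp (Real.pi / 2 * |w.im|) ^ (k - 1) := by gcongr
    _ = (2 * Real.sqrt Real.pi * C) ^ k * (Real.exp (-(Real.pi / 2 - 1 / k) * |w.im|) ^ k *
        Real.exp (Real.pi / 2 * |w.im|) ^ (k - 1)) := by ring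
    _ ≤ _ := by
      gcongr
      rw [← Real.exp_nat_mul, ← Real.exp_nat_mul, ← Real.exp_add, Nat.cast_sub hk]
      refine Real.exp_le_exp.2 ?_
      have : (k : ℝ) * (-(Real.pi / 2 - 1 / k) * |w.im|) +
          (k - (1 : ℕ)) * (Real.pi / 2 * |w.im|) = (1 - Real.pi / 2) * |w.im| := by
        field_simp
        push_cast
        ring
      rw [this]
      gcongr
      linarith

theorem norm_ofReal_cpow_neg {y : ℝ} (hy : 0 < y) (w : ℂ) :
    ‖(y : ℂ) ^ (-w)‖ = y ^ (-w.re) := by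
  simp [Complex.norm_cpow_eq_rpow_re_of_pos hy]

theorem exists_rpow_neg_le {y : ℝ} (hy : 0 < y) (a b : ℝ) :
    ∃ C : ℝ, 0 ≤ C ∧ ∀ x : ℝ, a ≤ x → x ≤ b → y ^ (-x) ≤ C := by
  obtain ⟨C, hC⟩ := (isCompact_Icc (a := a) (b := b)).exists_bound_of_continuousOn
    (f := fun x : ℝ => y ^ (-x))
    ((Real.continuous_const_rpow hy.ne').comp continuous_neg).continuousOn
  exact ⟨max C 0, le_max_right _ _, fun x h1 h2 =>
    (le_abs_self _).trans ((hC x ⟨h1, h2⟩).trans (le_max_left _ _))⟩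

theorem exists_norm_gammaKernel_mul_cpow_le {k : ℕ} (hk : 1 ≤ k) {y : ℝ} (hy : 0 < y) {a b : ℝ}
    (ha : 0 < a) :
    ∃ M : ℝ, ∀ w : ℂ, a ≤ w.re → w.re ≤ b →
      ‖gammaKernel k w * (y : ℂ) ^ (-w)‖ ≤ M * Real.exp (-(1 / 2) * |w.im|) := by
  obtain ⟨M, hM, h⟩ := exists_norm_gammaKernel_le hk (b := b) ha
  obtain ⟨C, hC, h'⟩ := exists_rpow_neg_le hy a b
  refine ⟨M * C, fun w h1 h2 => ?_⟩
  rw [norm_mul, norm_ofReal_cpow_neg hy]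
  calc _ ≤ (M * Real.exp (-(1 / 2) * |w.im|)) * C := by
        gcongr
        · exact h w h1 h2
        · exact h' _ h1 h2
    _ = _ := by ring

theorem differentiableAt_gammaKernel_mul_cpow (k : ℕ) {y : ℝ} (hy : 0 < y) {w : ℂ}
    (hw : 0 < w.re) : DifferentiableAt ℂ (fun w => gammaKernel k w * (y : ℂ) ^ (-w)) w :=
  (differentiableAt_gammaKernel k hw).mul
    (differentiableAt_id.neg.const_cpow (Or.inl (by exact_mod_cast hy.ne')))

theorem integrable_gammaKernel_mul_cpow {k : ℕ} (hk : 1 ≤ k) {y : ℝ} (hy : 0 < y) {a : ℝ}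
    (ha : 0 < a) :
    Integrable fun t : ℝ => gammaKernel k (a + t * I) * (y : ℂ) ^ (-(a + t * I) : ℂ) := by
  obtain ⟨M, h⟩ := exists_norm_gammaKernel_mul_cpow_le hk hy (b := a) ha
  refine integrable_of_norm_le_exp (M := M) (δ := 1 / 2) ?_ (by norm_num) fun t _ => ?_
  · refine continuous_iff_continuousAt.2 fun t => ?_
    exact ContinuousAt.comp (f := fun t : ℝ => (a + t * I : ℂ))
      (differentiableAt_gammaKernel_mul_cpow k hy (by simpa)).continuousAt (by fun_prop)
  · simpa using h (a + t * I) (by simp) (by simp)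

/-- Shift of the line of integration. -/
theorem integral_gammaKernel_mul_cpow_eq {k : ℕ} (hk : 1 ≤ k) {y : ℝ} (hy : 0 < y) {a b : ℝ}
    (ha : 0 < a) (hb : 0 < b) :
    (∫ t : ℝ, gammaKernel k (a + t * I) * (y : ℂ) ^ (-(a + t * I) : ℂ)) =
      ∫ t : ℝ, gammaKernel k (b + t * I) * (y : ℂ) ^ (-(b + t * I) : ℂ) := by
  wlog hab : a ≤ b generalizing a b
  · exact (this hb ha (le_of_not_ge hab)).symm
  rcases hab.eq_or_lt with rfl | hab
  · rfl
  obtain ⟨M, h⟩ := exists_norm_gammaKernel_mul_cpow_le hk hy (b := b) ha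
  have key := integral_line_sub_integral_line
    (f := fun w => gammaKernel k w * (y : ℂ) ^ (-w))
    (g := fun w => (w - ((a + b) / 2 : ℝ)) * (gammaKernel k w * (y : ℂ) ^ (-w)))
    (U := {w : ℂ | 0 < w.re}) (σ₁ := a) (σ₂ := b) (p := (a + b) / 2) (M := M) (δ := 1 / 2) 0
    (isOpen_lt continuous_const Complex.continuous_re)
    (fun w hw => (((differentiableAt_id.sub_const _).mul
      (differentiableAt_gammaKernel_mul_cpow k hy hw))).differentiableWithinAt)
    (fun z hz _ => ha.trans_le hz) (by linarith) (by linarith)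
    (fun z _ _ hz => by
      have : z - ((a + b) / 2 : ℝ) ≠ 0 := sub_ne_zero.2 hz
      rw [zero_add, pow_one, mul_div_cancel_left₀ _ this])
    (by norm_num) (fun z h1 h2 _ => h z h1 h2)
  simp only [iteratedDeriv_zero, sub_self, zero_mul, zero_div, mul_zero] at key
  exact (sub_eq_zero.1 key).symm

/-! ### The series as integrals over a line Re w > 1 -/

theorem sq_cpow {y : ℝ} (hy : 0 < y) (s : ℂ) :
    ((y ^ 2 : ℝ) : ℂ) ^ s = (y : ℂ) ^ (2 * s) := by
  have hy' : (y : ℂ) ≠ 0 := by exact_mod_cast hy.ne'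
  push_cast
  rw [pow_two, Complex.mul_cpow_ofReal_nonneg hy.le hy.le, two_mul, Complex.cpow_add _ _ hy']

theorem meijerGIntegrand_line {k : ℕ} (hk : 1 ≤ k) {c : ℝ} (hc : c < 0) {y : ℝ} (hy : 0 < y)
    (t : ℝ) :
    meijerGIntegrand (k + 1) 0 [] (psiParams k) ((y ^ 2 : ℝ) : ℂ) (c + t * I) =
      gammaKernel k ((-2 * c : ℝ) + (-2 * t : ℝ) * I) *
        (y : ℂ) ^ (-((-2 * c : ℝ) + (-2 * t : ℝ) * I) : ℂ) := by
  rw [meijerGIntegrand_psiParams hk _ (by simpa), sq_cpow hy]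
  congr 2 <;> push_cast <;> ring

theorem integrable_meijerGIntegrand {k : ℕ} (hk : 1 ≤ k) {c : ℝ} (hc : c < 0) {y : ℝ}
    (hy : 0 < y) :
    Integrable fun t : ℝ =>
      meijerGIntegrand (k + 1) 0 [] (psiParams k) ((y ^ 2 : ℝ) : ℂ) (c + t * I) := by
  simp_rw [meijerGIntegrand_line hk hc hy]
  exact (integrable_gammaKernel_mul_cpow hk hy (a := -2 * c) (by linarith)).comp_mul_left'
    (by norm_num : (-2 : ℝ) ≠ 0)

/-- The substitution w = -2s halves 1/(2π), and the shift theorem replaces -2c by any a > 0. Thus c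
plays no further role, and a > 1 may be taken for the Dirichlet series. -/
theorem meijerG_psiParams {k : ℕ} (hk : 1 ≤ k) {c : ℝ} (hc : c < 0) {y : ℝ} (hy : 0 < y) {a : ℝ}
    (ha : 0 < a) :
    meijerG c (k + 1) 0 [] (psiParams k) ((y ^ 2 : ℝ) : ℂ) =
      1 / (4 * Real.pi) *
        ∫ t : ℝ, gammaKernel k (a + t * I) * (y : ℂ) ^ (-(a + t * I) : ℂ) := by
  rw [meijerG, integral_mul_const]
  simp_rw [meijerGIntegrand_line hk hc hy]
  rw [Measure.integral_comp_mul_left (fun u : ℝ => gammaKernel k ((-2 * c : ℝ) + u * I) *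
      (y : ℂ) ^ (-((-2 * c : ℝ) + u * I) : ℂ)) (-2),
    integral_gammaKernel_mul_cpow_eq hk hy (by linarith : 0 < -2 * c) ha]
  have hπ : (Real.pi : ℂ) ≠ 0 := by exact_mod_cast Real.pi_ne_zero
  have e : |((-2 : ℝ))⁻¹| = 1 / 2 := by norm_num [abs_of_neg]
  rw [e, Complex.real_smul]
  push_cast
  have hI := I_ne_zero
  field_simp
  ring

theorem psiArg_eq (k : ℕ) (ρ x : ℝ) (j : ℕ+) : psiArg k ρ x j = (ρ * x / 2 ^ k * j) ^ 2 := by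
  rw [psiArg, pow_mul']
  ring

theorem hasSum_psiTerm {k : ℕ} (hk : 1 ≤ k) {c : ℝ} (hc : c < 0) {ρ x : ℝ} (hρ : 0 < ρ)
    (hx : 0 < x) {a : ℝ} (ha : 1 < a) :
    HasSum (psiTerm c k ρ x) (1 / (4 * Real.pi) * ∫ t : ℝ, gammaKernel k (a + t * I) *
      ((ρ * x / 2 ^ k : ℝ) : ℂ) ^ (-(a + t * I) : ℂ) * riemannZeta (a + t * I) ^ k) := by
  set X : ℝ := ρ * x / 2 ^ k with hX
  have hX0 : 0 < X := by positivity
  have h := (hasSum_integral_mul_piltz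
    (integrable_gammaKernel_mul_cpow hk hX0 (a := a) (by linarith)) k (a := a) (r := 0)
    (by linarith)).mul_left (1 / (4 * Real.pi) : ℂ)
  rw [add_zero] at h
  refine h.congr_fun ?_
  intro j
  have hj : (0 : ℝ) < j := by exact_mod_cast j.pos
  rw [psiTerm, psiArg_eq, ← hX, meijerG_psiParams hk hc (by positivity) (a := a) (by linarith)]
  simp only [ofReal_zero, neg_zero, cpow_zero, mul_one]
  rw [mul_left_comm]
  congr 2
  refine integral_congr_ae (Eventually.of_forall fun t => ?_)
  simp only
  rw [Complex.ofReal_mul, Complex.mul_cpow_ofReal_nonneg hX0.le hj.le]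
  push_cast
  ring

/-- The sum over j has already produced ζ(w)^k, bounded on this line; the weight 1/n makes the sum
over n produce ζ(w + 1)^k (the case r = 1). -/
theorem hasSum_etaTerm {k : ℕ} (hk : 1 ≤ k) {c : ℝ} (hc : c < 0) {ρ : ℝ} (hρ : 0 < ρ) {a : ℝ}
    (ha : 1 < a) :
    HasSum (etaTerm c k ρ) (((Real.pi ^ ((k : ℝ) / 2 - 1) / 2 ^ (k - 1) : ℝ) : ℂ) *
      (1 / (4 * Real.pi)) * ∫ t : ℝ, gammaKernel k (a + t * I) *
      ((ρ / 2 ^ k : ℝ) : ℂ) ^ (-(a + t * I) : ℂ) * riemannZeta (a + t * I) ^ k *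
      riemannZeta ((a + 1 : ℝ) + t * I) ^ k) := by
  set Y : ℝ := ρ / 2 ^ k with hY
  have hY0 : 0 < Y := by positivity
  have h := (hasSum_integral_mul_piltz (integrable_mul_riemannZeta_pow
    (integrable_gammaKernel_mul_cpow hk hY0 (a := a) (by linarith)) k ha) k (a := a) (r := 1)
    (by linarith)).mul_left
    (((Real.pi ^ ((k : ℝ) / 2 - 1) / 2 ^ (k - 1) : ℝ) : ℂ) * (1 / (4 * Real.pi)))
  refine h.congr_fun ?_
  intro n
  have hn : (0 : ℝ) < n := by exact_mod_cast n.pos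
  rw [etaTerm, Psi, (hasSum_psiTerm hk hc hρ hn ha).tsum_eq]
  have e : (∫ t : ℝ, gammaKernel k (a + t * I) *
      ((ρ * n / 2 ^ k : ℝ) : ℂ) ^ (-(a + t * I) : ℂ) * riemannZeta (a + t * I) ^ k) =
      ∫ t : ℝ, gammaKernel k (a + t * I) * (Y : ℂ) ^ (-(a + t * I) : ℂ) *
        riemannZeta (a + t * I) ^ k * (n : ℂ) ^ (-(a + t * I) : ℂ) := by
    refine integral_congr_ae (Eventually.of_forall fun t => ?_)
    simp only
    rw [show ρ * n / 2 ^ k = Y * n by rw [hY]; ring, Complex.ofReal_mul,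
      Complex.mul_cpow_ofReal_nonneg hY0.le hn.le]
    push_cast
    ring
  rw [e, ofReal_one, Complex.cpow_neg, Complex.cpow_one]
  ring

/-! ### The symmetric kernel and its residues -/

/-- The kernel `(ζ(1 - w) ζ(1 + w))^k / cos(π w / 2) * q ^ (-w)`. -/
noncomputable def zetaKernel (k : ℕ) (q : ℝ) (w : ℂ) : ℂ :=
  (riemannZeta (1 - w) * riemannZeta (1 + w)) ^ k / Complex.cos (Real.pi * w / 2) *
    (q : ℂ) ^ (-w)

theorem ofReal_cpow_eq_exp {x : ℝ} (hx : 0 < x) (s : ℂ) :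
    (x : ℂ) ^ s = Complex.exp (Real.log x * s) := by
  rw [Complex.cpow_def_of_ne_zero (by exact_mod_cast hx.ne'), Complex.ofReal_log hx.le]

theorem zetaKernel_neg (k : ℕ) {q : ℝ} (hq : 0 < q) (w : ℂ) :
    zetaKernel k q (-w) = zetaKernel k q⁻¹ w := by
  rw [zetaKernel, zetaKernel, ofReal_cpow_eq_exp hq, ofReal_cpow_eq_exp (inv_pos.2 hq),
    Real.log_inv, show (Real.pi * -w / 2 : ℂ) = -(Real.pi * w / 2) by ring, Complex.cos_neg,
    sub_neg_eq_add, ← sub_eq_add_neg, mul_comm (riemannZeta (1 + w))]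
  push_cast
  rw [neg_neg, neg_mul_neg]

theorem integral_zetaKernel_neg (k : ℕ) {q : ℝ} (hq : 0 < q) (σ : ℝ) :
    (∫ t : ℝ, zetaKernel k q ((-σ : ℝ) + t * I)) = ∫ t : ℝ, zetaKernel k q⁻¹ (σ + t * I) := by
  rw [← integral_neg_eq_self]
  refine integral_congr_ae (Eventually.of_forall fun t => ?_)
  simp only
  rw [← zetaKernel_neg k hq]
  congr 1
  push_cast
  ring

theorem exists_norm_zetaKernel_le {k : ℕ} (hk : 1 ≤ k) {q : ℝ} (hq : 0 < q) :
    ∃ M : ℝ, ∀ w : ℂ, -3 / 2 ≤ w.re → w.re ≤ 3 / 2 → 1 ≤ |w.im| →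
      ‖zetaKernel k q w‖ ≤ M * Real.exp (-(1 / 2) * |w.im|) := by
  have hπ := Real.pi_gt_three
  have hk0 : (0 : ℝ) < k := by exact_mod_cast hk
  -- The 2k zeta factors together grow at most like e^T, which loses to the e^(-πT/2) of the cosine.
  obtain ⟨C, hC, h⟩ := exists_norm_riemannZeta_le (ε := 1 / (2 * k)) (by positivity)
  obtain ⟨B, hB, hb⟩ := exists_rpow_neg_le hq (-3 / 2) (3 / 2)
  refine ⟨C ^ (2 * k) * 4 * B, fun w h1 h2 h3 => ?_⟩
  have b1 := h (1 - w) (by simp; linarith) (by simp; linarith) (by simpa using h3)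
  have b2 := h (1 + w) (by simp; linarith) (by simp; linarith) (by simpa using h3)
  simp only [sub_im, one_im, zero_sub, abs_neg, add_im, zero_add] at b1 b2
  have him : |(Real.pi * w / 2 : ℂ).im| = Real.pi / 2 * |w.im| := by
    rw [show (Real.pi * w / 2 : ℂ) = ((Real.pi / 2 : ℝ) : ℂ) * w by push_cast; ring,
      Complex.im_ofReal_mul, abs_mul, abs_of_pos (by positivity)]
  have b3 := Complex.exp_le_norm_cos (z := Real.pi * w / 2) (by rw [him]; nlinarith)
  rw [him] at b3
  rw [zetaKernel, norm_mul, norm_div, norm_pow, norm_mul, norm_ofReal_cpow_neg hq]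
  set T := |w.im| with hT
  calc (‖riemannZeta (1 - w)‖ * ‖riemannZeta (1 + w)‖) ^ k / ‖Complex.cos (Real.pi * w / 2)‖ *
        q ^ (-w.re)
      ≤ ((C * Real.exp (1 / (2 * k) * T)) * (C * Real.exp (1 / (2 * k) * T))) ^ k /
          (Real.exp (Real.pi / 2 * T) / 4) * B := by
        gcongr
        exact hb _ h1 h2
    _ = C ^ (2 * k) * 4 * B * (Real.exp (1 / (2 * k) * T) ^ (2 * k) /
          Real.exp (Real.pi / 2 * T)) := by
        rw [pow_mul, pow_mul]
        field_simp
        ring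
    _ ≤ _ := by
        gcongr
        rw [← Real.exp_nat_mul, ← Real.exp_sub]
        refine Real.exp_le_exp.2 ?_
        have : ((2 * k : ℕ) : ℝ) * (1 / (2 * k) * T) = T := by
          push_cast
          field_simp
        rw [this]
        nlinarith

/-- Reflection displays the zeros of the cosine as poles of Γ. At such a zero both sides are 0 by
convention. -/
theorem Complex.inv_cos_eq_Gamma_mul_Gamma (w : ℂ) :
    (Complex.cos (Real.pi * w / 2))⁻¹ =
      Complex.Gamma ((1 + w) / 2) * Complex.Gamma ((1 - w) / 2) / Real.pi := by
  have hπ : (Real.pi : ℂ) ≠ 0 := by exact_mod_cast Real.pi_ne_zero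
  have h := Complex.Gamma_mul_Gamma_one_sub ((1 + w) / 2)
  rw [show 1 - (1 + w) / 2 = (1 - w) / 2 by ring,
    show (Real.pi * ((1 + w) / 2) : ℂ) = Real.pi * w / 2 + Real.pi / 2 by ring,
    Complex.sin_add_pi_div_two] at h
  rw [h]
  field_simp

/-- The contribution of the pole at `1`. -/
theorem integral_zetaKernel_sub_of_pole_one {k : ℕ} (hk : 1 ≤ k) {q : ℝ} (hq : 0 < q) :
    (∫ t : ℝ, zetaKernel k q ((3 / 2 : ℝ) + t * I)) -
        ∫ t : ℝ, zetaKernel k q ((1 / 2 : ℝ) + t * I) =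
      2 * Real.pi * (-(2 / Real.pi) * (-(Real.pi ^ 2 / 12)) ^ k * (q : ℂ)⁻¹) := by
  have hπ : (Real.pi : ℂ) ≠ 0 := by exact_mod_cast Real.pi_ne_zero
  obtain ⟨M, hM⟩ := exists_norm_zetaKernel_le hk hq
  have key := integral_line_sub_integral_line (f := zetaKernel k q)
    -- From Γ((1-w)/2) = -2 Γ((3-w)/2)/(w - 1): the pole of 1/cos at 1 is split off and the other
    -- factors are holomorphic for 0 < Re w < 3.
    (g := fun w => (riemannZeta (1 - w) * riemannZeta (1 + w)) ^ k * (q : ℂ) ^ (-w) *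
      (-(2 / Real.pi) * (Complex.Gamma ((1 + w) / 2) * Complex.Gamma ((3 - w) / 2))))
    (U := {w : ℂ | 0 < w.re} ∩ {w : ℂ | w.re < 3}) (σ₁ := 1 / 2) (σ₂ := 3 / 2) (p := 1) (M := M)
    (δ := 1 / 2) 0
    ((isOpen_lt continuous_const Complex.continuous_re).inter
      (isOpen_lt Complex.continuous_re continuous_const))
    (fun w ⟨(hw1 : 0 < w.re), (hw2 : w.re < 3)⟩ => by
      refine DifferentiableAt.differentiableWithinAt ?_
      have hw0 : w ≠ 0 := by rintro rfl; simp at hw1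
      have d1 : DifferentiableAt ℂ (fun w : ℂ => riemannZeta (1 - w)) w :=
        DifferentiableAt.comp (f := fun w : ℂ => 1 - w) w
          (differentiableAt_riemannZeta (by simpa using hw0)) (by fun_prop)
      have d2 : DifferentiableAt ℂ (fun w : ℂ => riemannZeta (1 + w)) w :=
        DifferentiableAt.comp (f := fun w : ℂ => 1 + w) w
          (differentiableAt_riemannZeta (by simpa using hw0)) (by fun_prop)
      have d3 : DifferentiableAt ℂ (fun w : ℂ => (q : ℂ) ^ (-w)) w :=
        differentiableAt_id.neg.const_cpow (Or.inl (by exact_mod_cast hq.ne'))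
      have d4 : DifferentiableAt ℂ (fun w : ℂ => Complex.Gamma ((1 + w) / 2)) w :=
        DifferentiableAt.comp (f := fun w : ℂ => (1 + w) / 2) w
          (differentiableAt_Gamma_of_re_pos (by simp; linarith)) (by fun_prop)
      have d5 : DifferentiableAt ℂ (fun w : ℂ => Complex.Gamma ((3 - w) / 2)) w :=
        DifferentiableAt.comp (f := fun w : ℂ => (3 - w) / 2) w
          (differentiableAt_Gamma_of_re_pos (by simp; linarith)) (by fun_prop)
      exact (((d1.mul d2).pow k).mul d3).mul ((d4.mul d5).const_mul _))
    (fun z h1 h2 => ⟨by simp; linarith, by simp; linarith⟩) (by norm_num) (by norm_num)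
    (fun z _ _ hz => by
      have hz1 : z - 1 ≠ 0 := sub_ne_zero.2 (by simpa using hz)
      have hz2 : (1 - z) / 2 ≠ 0 := by
        intro h
        apply hz1
        linear_combination -2 * h
      rw [zetaKernel, div_eq_mul_inv, Complex.inv_cos_eq_Gamma_mul_Gamma,
        show (3 - z) / 2 = (1 - z) / 2 + 1 by ring, Complex.Gamma_add_one _ hz2]
      push_cast
      field_simp
      ring)
    (by norm_num) (fun z h1 h2 h3 => hM z (by linarith) h2 h3)
  rw [key]
  simp only [iteratedDeriv_zero, ofReal_one, Nat.factorial_zero, Nat.cast_one, div_one, sub_self,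
    riemannZeta_zero]
  rw [show (1 : ℂ) + 1 = 2 by norm_num, show (3 - 1 : ℂ) / 2 = 1 by norm_num, riemannZeta_two,
    div_self two_ne_zero, Complex.Gamma_one, Complex.cpow_neg_one]
  rw [show (-1 / 2 * (Real.pi ^ 2 / 6) : ℂ) = -(Real.pi ^ 2 / 12) by ring]
  ring

/-- Multiply the functional equations at w and -w: the powers of 2π cancel, and Γ(w)Γ(-w) =
-Γ(1+w)Γ(1-w)/w² isolates the double pole at 0. -/
theorem riemannZeta_one_sub_mul_riemannZeta_one_add {w : ℂ} (h0 : w ≠ 0) (h1 : |w.re| < 1) :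
    riemannZeta (1 - w) * riemannZeta (1 + w) =
      -4 * (Complex.Gamma (1 + w) * Complex.Gamma (1 - w) * riemannZeta w * riemannZeta (-w)) *
        Complex.cos (Real.pi * w / 2) ^ 2 / w ^ 2 := by
  have hπ : (2 * Real.pi : ℂ) ≠ 0 := by
    exact_mod_cast (mul_pos two_pos Real.pi_pos).ne'
  have hne : ∀ z : ℂ, z ≠ 0 → |z.re| < 1 → (∀ n : ℕ, z ≠ -n) ∧ z ≠ 1 := by
    intro z hz0 hz1
    constructor
    · intro n hn
      rw [hn] at hz1
      simp at hz1
      apply hz0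
      rw [hn, hz1]
      simp
    · rintro rfl
      simp at hz1
  obtain ⟨a1, a2⟩ := hne w h0 h1
  obtain ⟨b1, b2⟩ := hne (-w) (neg_ne_zero.2 h0) (by simpa using h1)
  have e1 := riemannZeta_one_sub a1 a2
  have e2 := riemannZeta_one_sub b1 b2
  rw [show 1 - -w = 1 + w by ring, show (Real.pi * -w / 2 : ℂ) = -(Real.pi * w / 2) by ring,
    Complex.cos_neg, neg_neg] at e2
  have g1 := Complex.Gamma_add_one w h0
  have g2 := Complex.Gamma_add_one (-w) (neg_ne_zero.2 h0)
  rw [add_comm] at g1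
  rw [show -w + 1 = 1 - w by ring] at g2
  have e3 : (2 * Real.pi : ℂ) ^ (-w) * (2 * Real.pi : ℂ) ^ w = 1 := by
    rw [← Complex.cpow_add _ _ hπ, neg_add_cancel, Complex.cpow_zero]
  rw [e1, e2, g1, g2]
  field_simp
  linear_combination (4 * Complex.Gamma w * Complex.cos (Real.pi * w / 2) ^ 2 * riemannZeta w *
    Complex.Gamma (-w) * riemannZeta (-w)) * e3

/-- The contribution of the pole at `0`. -/
theorem integral_zetaKernel_sub_of_pole_zero {k : ℕ} (hk : 1 ≤ k) {q : ℝ} (hq : 0 < q)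
    {h : ℂ → ℂ} (hh : ∀ s : ℂ, h s = Complex.Gamma (1 + s) ^ k * Complex.Gamma (1 - s) ^ k *
      riemannZeta s ^ k * riemannZeta (-s) ^ k * Complex.cos (Real.pi * s / 2) ^ (2 * k - 1) *
      (q : ℂ) ^ (-s)) :
    (∫ t : ℝ, zetaKernel k q ((1 / 2 : ℝ) + t * I)) -
        ∫ t : ℝ, zetaKernel k q ((-(1 / 2) : ℝ) + t * I) =
      2 * Real.pi * ((-4) ^ k * iteratedDeriv (2 * k - 1) h 0 / (2 * k - 1)!) := by
  obtain ⟨M, hM⟩ := exists_norm_zetaKernel_le hk hq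
  have key := integral_line_sub_integral_line (f := zetaKernel k q)
    (g := fun w => (-4) ^ k * h w)
    (U := {w : ℂ | -1 < w.re} ∩ {w : ℂ | w.re < 1}) (σ₁ := -(1 / 2)) (σ₂ := 1 / 2) (p := 0)
    (M := M) (δ := 1 / 2) (2 * k - 1)
    ((isOpen_lt continuous_const Complex.continuous_re).inter
      (isOpen_lt Complex.continuous_re continuous_const))
    (fun w ⟨(hw1 : -1 < w.re), (hw2 : w.re < 1)⟩ => by
      refine DifferentiableAt.differentiableWithinAt ?_
      rw [funext hh]
      have d1 : DifferentiableAt ℂ (fun w : ℂ => riemannZeta (-w)) w :=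
        DifferentiableAt.comp (f := fun w : ℂ => -w) w
          (differentiableAt_riemannZeta (by
            intro h
            have := congrArg Complex.re h
            simp at this
            linarith)) (by fun_prop)
      have d2 : DifferentiableAt ℂ riemannZeta w :=
        differentiableAt_riemannZeta (by rintro rfl; simp at hw2)
      have d3 : DifferentiableAt ℂ (fun w : ℂ => (q : ℂ) ^ (-w)) w :=
        differentiableAt_id.neg.const_cpow (Or.inl (by exact_mod_cast hq.ne'))
      have d4 : DifferentiableAt ℂ (fun w : ℂ => Complex.Gamma (1 + w)) w :=
        DifferentiableAt.comp (f := fun w : ℂ => 1 + w) w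
          (differentiableAt_Gamma_of_re_pos (by simp; linarith)) (by fun_prop)
      have d5 : DifferentiableAt ℂ (fun w : ℂ => Complex.Gamma (1 - w)) w :=
        DifferentiableAt.comp (f := fun w : ℂ => 1 - w) w
          (differentiableAt_Gamma_of_re_pos (by simp; linarith)) (by fun_prop)
      have d6 : DifferentiableAt ℂ
          (fun w : ℂ => Complex.cos (Real.pi * w / 2) ^ (2 * k - 1)) w := by fun_prop
      exact ((((((d4.pow k).mul (d5.pow k)).mul (d2.pow k)).mul (d1.pow k)).mul d6).mul
        d3).const_mul _)
    (fun z h1 h2 => ⟨by simp; linarith, by simp; linarith⟩) (by norm_num) (by norm_num)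
    (fun z h1 h2 hz => by
      have hz0 : z ≠ 0 := by simpa using hz
      rw [zetaKernel, riemannZeta_one_sub_mul_riemannZeta_one_add hz0
        (abs_lt.2 ⟨by linarith, by linarith⟩), hh, ofReal_zero, sub_zero,
        show 2 * k - 1 + 1 = 2 * k by omega]
      -- One cosine of the 2k is consumed by the denominator of the kernel, whence the exponent 2k -
      -- 1.
      have hcos : (Complex.cos (Real.pi * z / 2) ^ 2) ^ k / Complex.cos (Real.pi * z / 2) =
          Complex.cos (Real.pi * z / 2) ^ (2 * k - 1) := by
        rw [← pow_mul]
        obtain ⟨m, hm⟩ : ∃ m, 2 * k = m + 2 := ⟨2 * k - 2, by omega⟩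
        rw [hm, show m + 2 - 1 = m + 1 by omega]
        by_cases hc : Complex.cos (Real.pi * z / 2) = 0
        · simp [hc]
        · field_simp
          ring
      rw [← hcos, div_pow, mul_pow, mul_pow, mul_pow, mul_pow, mul_pow, pow_mul z]
      ring)
    (by norm_num) (fun z h1 h2 h3 => hM z (by linarith) (by linarith) h3)
  rw [key, ofReal_zero, iteratedDeriv_const_mul_field]

/-- Move from 3/2 to 1/2 to -1/2, reflect to 1/2 with q⁻¹, and move back to 3/2. The pole at -1 thus
appears as the pole at 1 for q⁻¹. -/
theorem integral_zetaKernel_sub_inv {k : ℕ} (hk : 1 ≤ k) {q : ℝ} (hq : 0 < q)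
    {h : ℂ → ℂ} (hh : ∀ s : ℂ, h s = Complex.Gamma (1 + s) ^ k * Complex.Gamma (1 - s) ^ k *
      riemannZeta s ^ k * riemannZeta (-s) ^ k * Complex.cos (Real.pi * s / 2) ^ (2 * k - 1) *
      (q : ℂ) ^ (-s)) :
    (∫ t : ℝ, zetaKernel k q ((3 / 2 : ℝ) + t * I)) -
        ∫ t : ℝ, zetaKernel k q⁻¹ ((3 / 2 : ℝ) + t * I) =
      2 * Real.pi * ((-4) ^ k * iteratedDeriv (2 * k - 1) h 0 / (2 * k - 1)! -
        (2 / Real.pi) * (-(Real.pi ^ 2 / 12)) ^ k * ((q : ℂ)⁻¹ - q)) := by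
  have h1 := integral_zetaKernel_sub_of_pole_one hk hq
  have h2 := integral_zetaKernel_sub_of_pole_one hk (inv_pos.2 hq)
  have h3 := integral_zetaKernel_sub_of_pole_zero hk hq hh
  rw [integral_zetaKernel_neg k hq] at h3
  rw [Complex.ofReal_inv, inv_inv] at h2
  linear_combination h1 - h2 + h3

/-! ### From the gamma kernel to the symmetric kernel -/

/-- The functional equation for ζ(1 - w)^k absorbs the gamma factors but needs k cosines where only
k - 1 are present, leaving 1/cos. The factor π^(wk) passes into q, and π^(k/2-1) √π^k cancels the
denominator π^(k-1). -/
theorem gammaKernel_mul_riemannZeta_pow {k : ℕ} (hk : 1 ≤ k) {Y : ℝ} (hY : 0 < Y) {w : ℂ}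
    (hw : 1 < w.re) (hw3 : w.re < 3) :
    ((Real.pi ^ ((k : ℝ) / 2 - 1) : ℝ) : ℂ) *
      (gammaKernel k w * (Y : ℂ) ^ (-w) * riemannZeta w ^ k * riemannZeta (1 + w) ^ k) =
      zetaKernel k (Y / Real.pi ^ k) w := by
  have hπ0 := Real.pi_pos
  have hπ : (Real.pi : ℂ) ≠ 0 := by exact_mod_cast Real.pi_ne_zero
  obtain ⟨m, rfl⟩ := Nat.exists_eq_add_of_le' hk
  have hw0 : ∀ n : ℕ, w ≠ -n := by
    rintro n rfl
    simp at hw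
    linarith [Nat.cast_nonneg (α := ℝ) n]
  have hw1 : w ≠ 1 := by rintro rfl; simp at hw
  have hcos : Complex.cos (Real.pi * w / 2) ≠ 0 := by
    have h := Complex.inv_cos_eq_Gamma_mul_Gamma w
    intro h0
    rw [h0, inv_zero, eq_comm, div_eq_zero_iff, mul_eq_zero] at h
    rcases h with (h | h) | h
    · exact Complex.Gamma_ne_zero_of_re_pos (by simp; linarith) h
    · obtain ⟨n, hn⟩ := (Complex.Gamma_eq_zero_iff _).1 h
      have hn' := congrArg Complex.re hn
      have e : ((1 - w) / 2).re = (1 - w.re) / 2 := by simp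
      rw [e] at hn'
      simp only [neg_re, natCast_re] at hn'
      have n0 : (0 : ℝ) < n := by linarith
      have n1 : (n : ℝ) < 1 := by linarith
      have : 0 < n := by exact_mod_cast n0
      have : n < 1 := by exact_mod_cast n1
      omega
    · exact hπ h
  have hfe := riemannZeta_one_sub hw0 hw1
  have e1 : ((Y / Real.pi ^ (m + 1) : ℝ) : ℂ) ^ (-w) =
      (Y : ℂ) ^ (-w) * ((Real.pi : ℂ) ^ w) ^ (m + 1) := by
    rw [ofReal_cpow_eq_exp (by positivity), ofReal_cpow_eq_exp hY, ofReal_cpow_eq_exp hπ0,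
      ← Complex.exp_nat_mul, ← Complex.exp_add, Real.log_div hY.ne' (by positivity), Real.log_pow]
    congr 1
    push_cast
    ring
  have e2 : (2 * Real.pi : ℂ) ^ (-w) * (Real.pi : ℂ) ^ w = (2 : ℂ) ^ (-w) := by
    have := Complex.mul_cpow_ofReal_nonneg two_pos.le hπ0.le (-w)
    push_cast at this
    rw [this, mul_assoc, ← Complex.cpow_add _ _ hπ, neg_add_cancel, Complex.cpow_zero, mul_one]
  have e3 : (2 : ℂ) ^ (1 - w) = 2 * (2 : ℂ) ^ (-w) := by
    rw [sub_eq_add_neg, Complex.cpow_add _ _ two_ne_zero, Complex.cpow_one]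
  have e4 : ((Real.pi ^ (((m + 1 : ℕ) : ℝ) / 2 - 1) : ℝ) : ℂ) *
      (Real.sqrt Real.pi : ℂ) ^ (m + 1) = (Real.pi : ℂ) ^ m := by
    rw [← Complex.ofReal_pow, ← Complex.ofReal_mul, ← Complex.ofReal_pow]
    congr 1
    rw [Real.sqrt_eq_rpow, ← Real.rpow_natCast, ← Real.rpow_natCast, ← Real.rpow_mul hπ0.le,
      ← Real.rpow_add hπ0]
    congr 1
    push_cast
    ring
  have e5 : (riemannZeta (1 - w) * (Real.pi : ℂ) ^ w) =
      2 * (2 : ℂ) ^ (-w) * Complex.Gamma w * Complex.cos (Real.pi * w / 2) * riemannZeta w := by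
    rw [hfe, ← e2]
    ring
  have e6 : zetaKernel (m + 1) (Y / Real.pi ^ (m + 1)) w =
      (riemannZeta (1 - w) * (Real.pi : ℂ) ^ w) ^ (m + 1) * riemannZeta (1 + w) ^ (m + 1) /
        Complex.cos (Real.pi * w / 2) * (Y : ℂ) ^ (-w) := by
    rw [zetaKernel, e1]
    ring
  rw [e6, e5, gammaKernel, e3, Nat.add_sub_cancel]
  have e7 : ((Real.pi ^ (((m + 1 : ℕ) : ℝ) / 2 - 1) : ℝ) : ℂ) *
      ((2 * (2 : ℂ) ^ (-w) * (Real.sqrt Real.pi : ℂ) * Complex.Gamma w) ^ (m + 1) *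
      (Complex.cos (Real.pi * w / 2) / Real.pi) ^ m * (Y : ℂ) ^ (-w) * riemannZeta w ^ (m + 1) *
      riemannZeta (1 + w) ^ (m + 1)) =
      (((Real.pi ^ (((m + 1 : ℕ) : ℝ) / 2 - 1) : ℝ) : ℂ) *
      (Real.sqrt Real.pi : ℂ) ^ (m + 1)) * ((2 * (2 : ℂ) ^ (-w) * Complex.Gamma w) ^ (m + 1) *
      (Complex.cos (Real.pi * w / 2) / Real.pi) ^ m * (Y : ℂ) ^ (-w) * riemannZeta w ^ (m + 1) *
      riemannZeta (1 + w) ^ (m + 1)) := by ring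
  rw [e7, e4, div_pow]
  generalize Complex.cos (Real.pi * w / 2) = C at hcos ⊢
  field_simp
  ring

theorem hasSum_etaTerm_zetaKernel {k : ℕ} (hk : 1 ≤ k) {c : ℝ} (hc : c < 0) {α : ℝ}
    (hα : 0 < α) :
    HasSum (etaTerm c k ((2 * α) ^ k)) (1 / (2 ^ (k + 1) * Real.pi) *
      ∫ t : ℝ, zetaKernel k ((α / Real.pi) ^ k) ((3 / 2 : ℝ) + t * I)) := by
  have hπ : (Real.pi : ℂ) ≠ 0 := by exact_mod_cast Real.pi_ne_zero
  have h := hasSum_etaTerm hk hc (ρ := (2 * α) ^ k) (by positivity) (a := 3 / 2) (by norm_num)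
  convert! h using 1
  have e : ∀ t : ℝ, zetaKernel k ((α / Real.pi) ^ k) ((3 / 2 : ℝ) + t * I) =
      ((Real.pi ^ ((k : ℝ) / 2 - 1) : ℝ) : ℂ) * (gammaKernel k ((3 / 2 : ℝ) + t * I) *
        (((2 * α) ^ k / 2 ^ k : ℝ) : ℂ) ^ (-((3 / 2 : ℝ) + t * I) : ℂ) *
        riemannZeta ((3 / 2 : ℝ) + t * I) ^ k *
        riemannZeta ((3 / 2 + 1 : ℝ) + t * I) ^ k) := by
    intro t
    have h2 : (2 * α) ^ k / 2 ^ k = α ^ k := by rw [mul_pow]; field_simp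
    rw [h2, div_pow, ← gammaKernel_mul_riemannZeta_pow hk (pow_pos hα k) (by simp; norm_num)
      (by simp)]
    congr 4
    push_cast
    ring
  rw [integral_congr_ae (Eventually.of_forall e), integral_const_mul,
    Complex.ofReal_div (Real.pi ^ ((k : ℝ) / 2 - 1)) (2 ^ (k - 1)), Complex.ofReal_pow 2,
    Complex.ofReal_ofNat 2]
  generalize (∫ t : ℝ, _ : ℂ) = J
  obtain ⟨m, rfl⟩ := Nat.exists_eq_add_of_le' hk
  rw [Nat.add_sub_cancel]
  field_simp
  ring

end

theorem theorem1p6 (k : ℕ) (hk : 1 ≤ k) (α β : ℝ) (hα : 0 < α) (hβ : 0 < β)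
    (hαβ : α * β = Real.pi ^ 2) (c : ℝ) (hc : c < 0) :
    -- all the integrals and series that occur converge (absolutely)
    (∀ ρ : ℝ, 0 < ρ → ∀ x : ℝ, 0 < x →
      (∀ j : ℕ+, MeasureTheory.Integrable fun t : ℝ =>
        meijerGIntegrand (k + 1) 0 [] (psiParams k) (psiArg k ρ x j : ℂ)
          (c + t * Complex.I)) ∧
      Summable (psiTerm c k ρ x)) ∧
    Summable (etaTerm c k ((2 * α) ^ k)) ∧
    Summable (etaTerm c k ((2 * β) ^ k)) ∧
    -- the transformation formula
    (∑' n : ℕ+, etaTerm c k ((2 * α) ^ k) n) - (∑' n : ℕ+, etaTerm c k ((2 * β) ^ k) n) =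
      (-1) ^ k * 2 ^ k / ((2 * k - 1)! : ℂ) *
        iteratedDeriv (2 * k - 1)
          (fun s : ℂ => Complex.Gamma (1 + s) ^ k * Complex.Gamma (1 - s) ^ k *
            riemannZeta s ^ k * riemannZeta (-s) ^ k *
            Complex.cos (Real.pi * s / 2) ^ (2 * k - 1) *
            ((α / β : ℝ) : ℂ) ^ (-(k * s) / 2)) 0 +
      2 * ((-1) ^ (k + 1) * (Real.pi : ℂ) ^ (k - 1) / 24 ^ k) * ((β : ℂ) ^ k - (α : ℂ) ^ k) := by
  have hπ0 := Real.pi_pos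
  have hπ : (Real.pi : ℂ) ≠ 0 := by exact_mod_cast Real.pi_ne_zero
  have hA := hasSum_etaTerm_zetaKernel hk hc hα
  have hB := hasSum_etaTerm_zetaKernel hk hc hβ
  refine ⟨fun ρ hρ x hx => ⟨fun j => ?_, (hasSum_psiTerm hk hc hρ hx one_lt_two).summable⟩,
    hA.summable, hB.summable, ?_⟩
  · have hj : (0 : ℝ) < j := by exact_mod_cast j.pos
    rw [psiArg_eq]
    exact integrable_meijerGIntegrand hk hc (by positivity)
  -- This is where αβ = π² enters: β has the reciprocal parameter q⁻¹.
  have hinv : β / Real.pi = (α / Real.pi)⁻¹ := by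
    rw [inv_div, div_eq_div_iff hπ0.ne' hα.ne']
    linarith
  have hdiv : α / β = (α / Real.pi) ^ 2 := by
    rw [div_pow, div_eq_div_iff hβ.ne' (by positivity), ← hαβ]
    ring
  rw [hA.tsum_eq, hB.tsum_eq, ← mul_sub, hinv, inv_pow,
    integral_zetaKernel_sub_inv hk (by positivity) (h := fun s : ℂ => Complex.Gamma (1 + s) ^ k *
      Complex.Gamma (1 - s) ^ k * riemannZeta s ^ k * riemannZeta (-s) ^ k *
      Complex.cos (Real.pi * s / 2) ^ (2 * k - 1) * ((α / β : ℝ) : ℂ) ^ (-(k * s) / 2)) (by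
        intro s
        congr 1
        -- As α/β = (α/π)², the factor (α/β)^(-ks/2) equals q^(-s).
        rw [hdiv, ofReal_cpow_eq_exp (by positivity), ofReal_cpow_eq_exp (by positivity),
          Real.log_pow, Real.log_pow]
        congr 1
        push_cast
        ring)]
  have e1 : (((α / Real.pi) ^ k : ℝ) : ℂ)⁻¹ = (β : ℂ) ^ k / (Real.pi : ℂ) ^ k := by
    rw [← Complex.ofReal_inv, ← inv_pow, ← hinv]
    push_cast
    rw [div_pow]
  have e2 : (((α / Real.pi) ^ k : ℝ) : ℂ) = (α : ℂ) ^ k / (Real.pi : ℂ) ^ k := by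
    push_cast
    rw [div_pow]
  have e3 : (-4 : ℂ) ^ k = (-1) ^ k * 2 ^ k * 2 ^ k := by
    rw [← mul_pow, ← mul_pow]; norm_num
  have e4 : (24 : ℂ) ^ k = 2 ^ k * 12 ^ k := by
    rw [← mul_pow]; norm_num
  have hf : ((2 * k - 1)! : ℂ) ≠ 0 := by exact_mod_cast Nat.factorial_ne_zero _
  rw [e1, e2, e3, e4, neg_pow ((Real.pi : ℂ) ^ 2 / 12), div_pow, ← pow_mul]
  generalize (iteratedDeriv (2 * k - 1) (_ : ℂ → ℂ) (0 : ℂ) : ℂ) = D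
  obtain ⟨m, rfl⟩ := Nat.exists_eq_add_of_le' hk
  rw [Nat.add_sub_cancel]
  field_simp
  ring
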